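/- Let $\kappa$ be a field of characteristic zero with algebraic closure $\bar\kappa$. Let $G$ and $G'$ be connected algebraic groups over $\kappa$ (geometrically integral group schemes of finite type, not necessarily linear), and let $X$ be an algebraic variety over $\kappa$ (a separated scheme of finite type, not necessarily irreducible), on which $G$ acts by a $\kappa$-morphism $G\times X\to X$. Let $p:G'\to G$ be an isogeny (a finite surjective homomorphism of algebraic groups) and let $\theta:G'\dashrightarrow X$ be a rational map, both defined over $\kappa$, such that $p(g)(\theta(g))=\theta(g)$ for every $g\in G'(\bar\kappa)$ in the domain of $\theta$. Suppose that for at least one $g_0\in G'(\bar\kappa)$ in the domain of $\theta$ the element $p(g_0)$ of $G$ has only finitely many fixed points in $X(\bar\kappa)$ (this holds in particular if the generic element of $G$ has only finitely many fixed points). Then $\theta$ is constant on the fibers of $p$: if $g_1,g_2\in G'(\bar\kappa)$ lie in the domain of $\theta$ and $p(g_1)=p(g_2)$, then $\theta(g_1)=\theta(g_2)$. Moreover there is a rational map $\omega:G\dashrightarrow X$, defined over $\kappa$, with $\theta=\omega\circ p$ as rational maps, and $g(\omega(g))=\omega(g)$ for every $g\in G(\bar\kappa)$ in the domain of $\omega$.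 -/

import Mathlib

open AlgebraicGeometry CategoryTheory MonoidalCategory CartesianMonoidalCategory

universe u

namespace FixedPoints

variable {κ : Type u} [Field κ]

/-- The spectrum of an algebraic closure of `κ`, as a `κ`-scheme. A geometric point of a `κ`-scheme
`Y`, i.e. an element of `Y(κ̄)`, is a morphism `geomPt κ ⟶ Y` of `κ`-schemes. -/
noncomputable def geomPt (κ : Type u) [Field κ] : Over (Spec (CommRingCat.of κ)) :=
  Over.mk (Spec.map (CommRingCat.ofHom (algebraMap κ (AlgebraicClosure κ))))

/-- The point `g(x)` obtained when `g : T ⟶ G` acts on `x : T ⟶ X`,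
for an action of the group scheme `G` on `X`. -/
noncomputable def act {G X T : Over (Spec (CommRingCat.of κ))} [GrpObj G] [ModObj G X]
    (g : T ⟶ G) (x : T ⟶ X) : T ⟶ X :=
  lift g x ≫ ModObj.smul (M := G) (X := X)

/-- The set of points of `X(κ̄)` fixed by `g ∈ G(κ̄)`. -/
def fixedPoints {G : Over (Spec (CommRingCat.of κ))} (X : Over (Spec (CommRingCat.of κ)))
    [GrpObj G] [ModObj G X] (g : geomPt κ ⟶ G) : Set (geomPt κ ⟶ X) :=
  {x | act g x = x}

/-- An isogeny: a finite surjective homomorphism of group schemes. -/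
structure IsIsogeny {G' G : Over (Spec (CommRingCat.of κ))} [GrpObj G'] [GrpObj G]
    (p : G' ⟶ G) : Prop where
  isMonHom : IsMonHom p
  isFinite : IsFinite p.left
  surjective : Surjective p.left

/-- The rational map `θ` is defined over `κ`, i.e. compatible with the structure morphisms. -/
def DefinedOverBase {Y X : Over (Spec (CommRingCat.of κ))} (θ : Y.left ⤏ X.left) : Prop :=
  θ.compHom X.hom = Y.hom.toRationalMap

/-- `HasValue θ y x` says that the geometric point `y` lies in the domain of definition of the
rational map `θ` and that `θ(y) = x`: some representative of `θ` is defined at `y` and sends `y`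
to `x`. -/
def HasValue {Y X : Over (Spec (CommRingCat.of κ))} (θ : Y.left ⤏ X.left)
    (y : geomPt κ ⟶ Y) (x : geomPt κ ⟶ X) : Prop :=
  ∃ f : Y.left.PartialMap X.left, f.toRationalMap = θ ∧
    ∃ h : (geomPt κ).left ⟶ f.domain.toScheme, h ≫ f.domain.ι = y.left ∧ h ≫ f.hom = x.left

/-- The composite `ω ∘ p` of an isogeny `p : G' ⟶ G` with a rational map `ω : G ⤏ X`. -/
noncomputable def compIsogeny {G' G : Over (Spec (CommRingCat.of κ))} [GrpObj G'] [GrpObj G]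
    [GeometricallyIntegral G'.hom] [GeometricallyIntegral G.hom] {X : Scheme.{u}}
    (p : G' ⟶ G) (hp : IsIsogeny p) (ω : G.left ⤏ X) : G'.left ⤏ X :=
  haveI : IsIntegral G'.left := GeometricallyIntegral.isIntegral_of_subsingleton G'.hom
  haveI : IsIntegral G.left := GeometricallyIntegral.isIntegral_of_subsingleton G.hom
  haveI : Surjective p.left := hp.surjective
  p.left.toRationalMap.comp ω

end FixedPoints

/-! Write `f : U ⟶ X` for `θ` on its domain of definition.

Isolation. The pairs (u, x) with `p(u)x = x` form a scheme over `U`, of which `u ↦ (u, f(u))` is a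
section. Finiteness of the fixed points at `g₀` makes this scheme quasi-finite at one point of the
section. Quasi-finiteness is an open condition, so `f(b)` is an isolated fixed point of `p(b)` for
generic `b` (`isIsolatedFixed_of_finite`).

Rigidity. For such `b`, the points `p(y)⁻¹ f(y b y⁻¹)` are fixed by `p(b)` and equal `f(b)` at `y =
1`. They form an irreducible family through an isolated point, so the family is constant. Taking `y
= a` in the centralizer of `b`, `p(a)` fixes `f(b)` (`smul_eq_of_commute`).

Powers. In characteristic zero the power maps are dominant (`isDominant_id_pow`), so the powers of a
generic `a` are generic. By rigidity all `f(a ^ Mⁿ)` are fixed by `p(a)`, and they are isolated.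
Only finitely many are distinct, whence `f(b) = f(b ^ N)` for generic `b` and some positive multiple
`N` of `M` (`exists_pow_comp_eq`).

Conclusion. If `c` lies in the kernel of `p`, which is finite and normal, then `(cA) ^ M = A ^ M`
for some `M > 0`. Hence `f(cA) = f((cA) ^ N) = f(A ^ N) = f(A)` for generic `A`, and specializing
`A` gives constancy on fibres (`comp_eq_of_comp_eq`). This holds for points in any field, so the
value of `f` at the generic point of `G'` does not distinguish conjugates over the function field of
`G`. By separability it descends there, and this defines `ω`. -/

namespace FixedPoints

open Limits MonObj TopologicalSpace

/-! ### Field-valued points -/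

/-- The scheme underlying `T` is the spectrum of a field. -/
class IsFieldSpec {S : Scheme.{u}} (T : Over S) : Prop where
  exists_iso : ∃ (L : Type u) (_ : Field L), Nonempty (T.left ≅ Spec (CommRingCat.of L))

section FieldSpec

variable {S : Scheme.{u}}

instance isFieldSpec_mk (L : Type u) [Field L] (s : Spec (CommRingCat.of L) ⟶ S) :
    IsFieldSpec (Over.mk s) := ⟨L, inferInstance, ⟨Iso.refl _⟩⟩

instance (κ : Type u) [Field κ] : IsFieldSpec (geomPt κ) := isFieldSpec_mk _ _

variable (T : Over S) [IsFieldSpec T]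

instance (priority := 100) IsFieldSpec.subsingleton : Subsingleton T.left := by
  obtain ⟨L, _, ⟨e⟩⟩ := IsFieldSpec.exists_iso (T := T)
  exact (e.hom.homeomorph.toEquiv).injective.subsingleton

instance (priority := 100) IsFieldSpec.isIntegral : IsIntegral T.left := by
  obtain ⟨L, _, ⟨e⟩⟩ := IsFieldSpec.exists_iso (T := T)
  have : Nonempty T.left := ⟨e.inv default⟩
  exact isIntegral_of_isOpenImmersion e.hom

instance (priority := 100) IsFieldSpec.isNoetherian : IsNoetherian T.left := by
  obtain ⟨L, _, ⟨e⟩⟩ := IsFieldSpec.exists_iso (T := T)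
  have : IsLocallyNoetherian T.left := isLocallyNoetherian_of_isOpenImmersion e.hom
  have : CompactSpace T.left := inferInstance
  exact { }

end FieldSpec

/-! ### Generic points and lifting to open subschemes -/

section Over

variable {S : Scheme.{u}}

lemma over_ext_of_isDominant {T' T X : Over S} [IsReduced T.left] [IsSeparated X.hom]
    (d : T' ⟶ T) [IsDominant d.left] {f g : T ⟶ X} (h : d ≫ f = d ≫ g) : f = g := by
  refine Over.OverMorphism.ext (ext_of_isDominant_of_isSeparated X.hom ?_ d.left ?_)
  · rw [Over.w, Over.w]
  · rw [← Over.comp_left, h, Over.comp_left]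

/-- The generic point of an integral scheme, as a scheme over the base. -/
noncomputable def genericPt (Y : Over S) [IsIntegral Y.left] : Over S :=
  Over.mk (Y.left.fromSpecStalk (genericPoint Y.left) ≫ Y.hom)

/-- The inclusion of the generic point of an integral scheme. -/
noncomputable def genericPtHom (Y : Over S) [IsIntegral Y.left] : genericPt Y ⟶ Y :=
  Over.homMk (Y.left.fromSpecStalk (genericPoint Y.left)) rfl

instance (Y : Over S) [IsIntegral Y.left] : IsFieldSpec (genericPt Y) :=
  ⟨Y.left.functionField, inferInstance, ⟨Iso.refl _⟩⟩

lemma isDominant_of_apply_eq_genericPoint {T Y : Scheme.{u}} [IrreducibleSpace Y] (t : T ⟶ Y)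
    (x : T) (h : t x = genericPoint Y) : IsDominant t := by
  refine ⟨dense_iff_closure_eq.mpr (Set.eq_univ_of_univ_subset ?_)⟩
  rw [← genericPoint_closure Y, ← h]
  exact closure_mono (by simp)

lemma apply_eq_genericPoint {T Y : Scheme.{u}} [IrreducibleSpace Y] [Subsingleton T]
    (t : T ⟶ Y) [IsDominant t] (x : T) : t x = genericPoint Y := by
  have h : Set.range t = {t x} := by
    ext y
    refine ⟨?_, ?_⟩
    · rintro ⟨z, rfl⟩
      rw [Subsingleton.elim z x]; rfl
    · rintro rfl
      exact ⟨x, rfl⟩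
  have h2 : closure {t x} = Set.univ := by
    rw [← h]; exact t.denseRange.closure_eq
  exact (genericPoint_spec Y).eq h2 |>.symm

instance (Y : Over S) [IsIntegral Y.left] : IsDominant (genericPtHom Y).left := by
  refine isDominant_of_apply_eq_genericPoint _
    (IsLocalRing.closedPoint (Y.left.presheaf.stalk (genericPoint Y.left))) ?_
  exact Scheme.fromSpecStalk_closedPoint

/-- A dominant field-valued point hits the generic point, hence factors through its local scheme.
Facts about the tautological generic point thus pass to every dominant one. -/
lemma exists_comp_genericPtHom {T Y : Over S} [IsFieldSpec T] [IsIntegral Y.left]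
    (t : T ⟶ Y) [IsDominant t.left] : ∃ φ : T ⟶ genericPt Y, φ ≫ genericPtHom Y = t := by
  obtain ⟨L, _, ⟨e⟩⟩ := IsFieldSpec.exists_iso (T := T)
  let f : Spec (CommRingCat.of L) ⟶ Y.left := e.inv ≫ t.left
  have hf : f (IsLocalRing.closedPoint L) = genericPoint Y.left := apply_eq_genericPoint f _
  have key : ∀ y : Y.left, f (IsLocalRing.closedPoint L) = y →
      ∃ ψ : Spec (CommRingCat.of L) ⟶ Spec (Y.left.presheaf.stalk y),
        ψ ≫ Y.left.fromSpecStalk y = f := by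
    rintro _ rfl
    exact ⟨_, Scheme.Spec_stalkClosedPointTo_fromSpecStalk f⟩
  obtain ⟨ψ, hψ⟩ := key _ hf
  have h : (e.hom ≫ ψ) ≫ Y.left.fromSpecStalk (genericPoint Y.left) = t.left := by
    rw [Category.assoc, hψ, Iso.hom_inv_id_assoc]
  refine ⟨Over.homMk (e.hom ≫ ψ) ?_, ?_⟩
  · change (e.hom ≫ ψ) ≫ Y.left.fromSpecStalk (genericPoint Y.left) ≫ Y.hom = _
    rw [← Category.assoc, h, Over.w]
  · ext1
    exact h

lemma isDominant_of_isFieldSpec {T T' : Over S} [IsFieldSpec T] [IsFieldSpec T'] (t : T ⟶ T') :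
    IsDominant t.left := by
  obtain ⟨x⟩ : Nonempty T.left := inferInstance
  exact ⟨fun y ↦ subset_closure ⟨x, Subsingleton.elim _ _⟩⟩

lemma isDominant_left_comp {T T' Y : Over S} (a : T ⟶ T') (b : T' ⟶ Y) [IsDominant a.left]
    [IsDominant b.left] : IsDominant (a ≫ b).left := by
  rw [Over.comp_left]; infer_instance

lemma exists_lift_of_range_subset {T U Y : Over S} (j : U ⟶ Y) [IsOpenImmersion j.left] (t : T ⟶ Y)
    (h : Set.range t.left ⊆ Set.range j.left) : ∃ u : T ⟶ U, u ≫ j = t := by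
  refine ⟨Over.homMk (IsOpenImmersion.lift j.left t.left h) ?_, ?_⟩
  · rw [← Over.w j, IsOpenImmersion.lift_fac_assoc, Over.w]
  · ext1; exact IsOpenImmersion.lift_fac _ _ _

/-- A generic point of an irreducible scheme lies in every nonempty open subscheme. -/
lemma exists_lift_of_isDominant {T U Y : Over S} [IsFieldSpec T] [IrreducibleSpace Y.left]
    (j : U ⟶ Y) [IsOpenImmersion j.left] [Nonempty U.left] (t : T ⟶ Y) [IsDominant t.left] :
    ∃ u : T ⟶ U, u ≫ j = t := by
  have h : Set.range t.left ⊆ Set.range j.left := by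
    rintro _ ⟨x, rfl⟩
    rw [apply_eq_genericPoint t.left x]
    obtain ⟨z⟩ := ‹Nonempty U.left›
    exact ((genericPoint_spec Y.left).mem_open_set_iff j.left.isOpenEmbedding.isOpen_range).mpr
      ⟨j.left z, by simp⟩
  exact exists_lift_of_range_subset j t h

end Over

/-! ### Geometric points -/

section GeometricPoints

variable {κ : Type u} [Field κ]

/-- Every closed point of a scheme locally of finite type over a field underlies a point with values
in any given algebraically closed extension. -/
lemma exists_point_of_isClosed {k Ω : Type u} [Field k] [Field Ω] [IsAlgClosed Ω]
    (ω : Spec (CommRingCat.of Ω) ⟶ Spec (CommRingCat.of k)) {F : Scheme.{u}}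
    (h : F ⟶ Spec (CommRingCat.of k)) [LocallyOfFiniteType h] (x : F) (hx : IsClosed {x}) :
    ∃ φ : Spec (CommRingCat.of Ω) ⟶ Spec (F.residueField x),
      φ ≫ F.fromSpecResidueField x ≫ h = ω := by
  have hfin : IsFinite (F.fromSpecResidueField x ≫ h) := by
    rw [isClosed_singleton_iff_isClosedImmersion] at hx
    rw [isFinite_iff_locallyOfFiniteType_of_jacobsonSpace]
    infer_instance
  obtain ⟨φ, hφ⟩ := Spec.map_surjective (F.fromSpecResidueField x ≫ h)
  obtain ⟨ω, rfl⟩ := Spec.map_surjective ω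
  rw [← hφ, IsFinite.SpecMap_iff] at hfin
  algebraize [φ.hom, ω.hom]
  have : Module.Finite k (F.residueField x) := hfin
  obtain ⟨α, hα⟩ : ∃ α : F.residueField x ⟶ CommRingCat.of Ω, φ ≫ α = ω := by
    let ψ : F.residueField x →ₐ[k] Ω := IsAlgClosed.lift
    refine ⟨CommRingCat.ofHom ψ.toRingHom, ?_⟩
    ext y
    exact ψ.commutes y
  refine ⟨Spec.map α, ?_⟩
  rw [← hφ, ← Spec.map_comp, hα]

/-- Closed points are dense in a Jacobson scheme and each underlies a geometric point; reducedness
and separatedness do the rest. -/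
lemma ext_of_geomPt {U X : Over (Spec (CommRingCat.of κ))} [LocallyOfFiniteType U.hom]
    [IsReduced U.left] [IsSeparated X.hom] {f g : U ⟶ X}
    (h : ∀ u : geomPt κ ⟶ U, u ≫ f = u ≫ g) : f = g := by
  have : JacobsonSpace U.left := LocallyOfFiniteType.jacobsonSpace U.hom
  ext1
  refine ext_of_fromSpecResidueField_eq f.left g.left X.hom (closedPoints U.left) ?_ ?_ (by simp)
  · rw [dense_iff_closure_eq]
    exact closure_closedPoints
  · intro x hx
    obtain ⟨φ, hφ⟩ := exists_point_of_isClosed (geomPt κ).hom U.hom x hx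
    obtain ⟨u, hu⟩ : ∃ u : geomPt κ ⟶ U, u.left = φ ≫ U.left.fromSpecResidueField x :=
      ⟨Over.homMk (φ ≫ U.left.fromSpecResidueField x) ((Category.assoc _ _ _).trans hφ), rfl⟩
    obtain ⟨z⟩ : Nonempty (geomPt κ).left := inferInstance
    have hφ : IsDominant φ := ⟨fun y ↦ subset_closure ⟨z, Subsingleton.elim _ _⟩⟩
    refine ext_of_isDominant_of_isSeparated X.hom (by simp) φ ?_
    rw [← Category.assoc, ← Category.assoc, ← hu]
    exact congr(($(h u)).left)

end GeometricPoints

/-! ### Isolated fixed points -/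

section Isolated

variable {S : Scheme.{u}}

/-- The preimage of an open subscheme under a morphism, with its universal property. -/
lemma exists_open_preimage {U Y Y' : Over S} (j : U ⟶ Y') [IsOpenImmersion j.left] (c : Y ⟶ Y') :
    ∃ (W : Over S) (i : W ⟶ Y) (v : W ⟶ U), IsOpenImmersion i.left ∧ v ≫ j = i ≫ c ∧
      ∀ (T : Over S) (t : T ⟶ Y) (u : T ⟶ U), u ≫ j = t ≫ c → ∃ w : T ⟶ W, w ≫ i = t ∧ w ≫ v = u := by
  let O : Y.left.Opens := c.left ⁻¹ᵁ j.left.opensRange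
  let W : Over S := Over.mk (O.ι ≫ Y.hom)
  let i : W ⟶ Y := Over.homMk O.ι rfl
  have hi : IsOpenImmersion i.left := inferInstanceAs (IsOpenImmersion O.ι)
  have hir : Set.range i.left = O := O.range_ι
  obtain ⟨v, hv⟩ := exists_lift_of_range_subset j (i ≫ c) (by
    rintro _ ⟨x, rfl⟩
    have : i.left x ∈ (O : Set Y.left) := hir ▸ ⟨x, rfl⟩
    rw [Over.comp_left, Scheme.Hom.comp_apply]
    exact this)
  refine ⟨W, i, v, hi, hv, fun T t u h ↦ ?_⟩
  obtain ⟨w, hw⟩ := exists_lift_of_range_subset i t (by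
    rw [hir]
    rintro _ ⟨x, rfl⟩
    change c.left (t.left x) ∈ Set.range j.left
    rw [← Scheme.Hom.comp_apply, ← Over.comp_left, ← h]
    exact ⟨u.left x, rfl⟩)
  refine ⟨w, hw, ?_⟩
  have : Mono j := Over.mono_of_mono_left j
  rw [← cancel_mono j, Category.assoc, hv, ← Category.assoc, hw, h]

variable {G X : Over S} [GrpObj G] [ModObj G X]

/-- The `T`-point `x` of `X` is isolated among the fixed points of the `T`-point `g` of `G`: on some
open neighbourhood of `x` in `T × X`, it is the only field-valued fixed point of `g`. -/
def IsIsolatedFixed {T : Over S} (g : T ⟶ G) (x : T ⟶ X) : Prop :=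
  ∃ O : (T ⊗ X).left.Opens, (∀ z, (lift (𝟙 T) x).left z ∈ O) ∧
    ∀ (E : Over S) [IsFieldSpec E] (t : E ⟶ T) (y : E ⟶ X),
      (∀ z, (lift t y).left z ∈ O) → (t ≫ g) • y = y → y = t ≫ x

/-- The definition tests all field-valued points over `T`, so the preimage of the same open set
works over `T'`. -/
lemma IsIsolatedFixed.baseChange {T T' : Over S} {g : T ⟶ G} {x : T ⟶ X}
    (h : IsIsolatedFixed g x) (φ : T' ⟶ T) : IsIsolatedFixed (φ ≫ g) (φ ≫ x) := by
  obtain ⟨O, hO, h⟩ := h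
  have key {E : Over S} (t : E ⟶ T') (y : E ⟶ X) (z : E.left) :
      (φ ▷ X).left ((lift t y).left z) = (lift (t ≫ φ) y).left z := by
    rw [← Scheme.Hom.comp_apply, ← Over.comp_left, lift_whiskerRight]
  refine ⟨(φ ▷ X).left ⁻¹ᵁ O, fun z ↦ ?_, fun E _ t y hy hfix ↦ ?_⟩
  · change (φ ▷ X).left _ ∈ O
    rw [key, show lift (𝟙 T' ≫ φ) (φ ≫ x) = φ ≫ lift (𝟙 T) x by simp]
    rw [Over.comp_left, Scheme.Hom.comp_apply]
    exact hO _
  · rw [← Category.assoc]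
    refine h E (t ≫ φ) y (fun z ↦ ?_) (by rwa [Category.assoc])
    rw [← key]
    exact hy z

lemma IsIsolatedFixed.of_imp {T : Over S} {g g' : T ⟶ G} {x : T ⟶ X}
    (h : IsIsolatedFixed g x)
    (H : ∀ (E : Over S) (t : E ⟶ T) (y : E ⟶ X), (t ≫ g') • y = y → (t ≫ g) • y = y) :
    IsIsolatedFixed g' x := by
  obtain ⟨O, hO, h⟩ := h
  exact ⟨O, hO, fun E _ t y hy hfix ↦ h E t y hy (H E t y hfix)⟩

/-- Whatever `g` fixes, `g ^ n` fixes too, so `g` has fewer competitors to exclude. -/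
lemma IsIsolatedFixed.of_pow {T : Over S} {g : T ⟶ G} {x : T ⟶ X} (n : ℕ)
    (h : IsIsolatedFixed (g ^ n) x) : IsIsolatedFixed g x :=
  h.of_imp fun E t y hy ↦ by
    rw [comp_pow]
    exact pow_mem (S := MulAction.stabilizer (E ⟶ G) y) hy n

/-- An isolated fixed point does not move in a family of fixed points with integral base. -/
lemma IsIsolatedFixed.eq_of_isIntegral {T T' W : Over S} [Nonempty T'.left] {g : T ⟶ G} {x : T ⟶ X}
    (h : IsIsolatedFixed g x) [IsIntegral W.left] [IsSeparated X.hom] (w : W ⟶ T) (ψ : W ⟶ X)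
    (hψ : (w ≫ g) • ψ = ψ) (w₀ : T' ⟶ W) (hw₀ : w₀ ≫ ψ = w₀ ≫ w ≫ x) : ψ = w ≫ x := by
  obtain ⟨O, hO, h⟩ := h
  refine over_ext_of_isDominant (genericPtHom W) ?_
  rw [← Category.assoc]
  refine h _ _ _ (fun z ↦ ?_) ?_
  · rw [← comp_lift, Over.comp_left, Scheme.Hom.comp_apply,
      apply_eq_genericPoint (genericPtHom W).left z]
    obtain ⟨z'⟩ := ‹Nonempty T'.left›
    -- The generic point of `W` lies in the open preimage of `O` because this preimage contains a
    -- point of `w₀`.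
    refine ((genericPoint_spec W.left).mem_open_set_iff ((lift w ψ).left ⁻¹ᵁ O).2).mpr
      ⟨w₀.left z', trivial, ?_⟩
    change (lift w ψ).left (w₀.left z') ∈ O
    rw [← Scheme.Hom.comp_apply, ← Over.comp_left, comp_lift, hw₀,
      show lift (w₀ ≫ w) (w₀ ≫ w ≫ x) = (w₀ ≫ w) ≫ lift (𝟙 T) x by simp,
      Over.comp_left, Scheme.Hom.comp_apply]
    exact hO _
  · rw [Category.assoc, ← ModObj.comp_smul, hψ]

lemma isNoetherian_tensor {T X : Over S} [LocallyOfFiniteType X.hom] [QuasiCompact X.hom]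
    [IsNoetherian T.left] : IsNoetherian (T ⊗ X).left := by
  have h1 : LocallyOfFiniteType (fst T X).left :=
    inferInstanceAs (LocallyOfFiniteType (pullback.fst T.hom X.hom))
  have h2 : QuasiCompact (fst T X).left :=
    inferInstanceAs (QuasiCompact (pullback.fst T.hom X.hom))
  have := LocallyOfFiniteType.isLocallyNoetherian (fst T X).left
  have : CompactSpace (T ⊗ X).left := QuasiCompact.compactSpace_of_compactSpace (fst T X).left
  exact { }

/-- There are only finitely many isolated fixed points. -/
lemma exists_eq_of_isIsolatedFixed [LocallyOfFiniteType X.hom] [QuasiCompact X.hom]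
    {T : Over S} [IsFieldSpec T] (g : T ⟶ G) (x : ℕ → (T ⟶ X)) (hx : ∀ n, g • x n = x n)
    (h : ∀ n, IsIsolatedFixed g (x n)) : ∃ m n, m < n ∧ x m = x n := by
  have : IsNoetherian (T ⊗ X).left := isNoetherian_tensor
  have : NoetherianSpace (T ⊗ X).left := inferInstance
  choose O hO h using h
  have : WellFoundedGT (Opens (T ⊗ X).left) := inferInstanceAs (NoetherianSpace (T ⊗ X).left)
  -- The unions of the isolating neighbourhoods stabilize, so `x (n + 1)` lies in the neighbourhood
  -- of some earlier `x m` and must equal it.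
  obtain ⟨n, hn⟩ := WellFoundedGT.monotone_chain_condition (partialSups O)
  obtain ⟨z⟩ : Nonempty T.left := inferInstance
  have h1 : (lift (𝟙 T) (x (n + 1))).left z ∈ partialSups O (n + 1) :=
    le_partialSups O (n + 1) (hO _ z)
  rw [← hn (n + 1) (Nat.le_succ n), partialSups_eq_biSup] at h1
  simp only [Opens.mem_iSup] at h1
  obtain ⟨m, hm, h1⟩ := h1
  refine ⟨m, n + 1, Nat.lt_succ_of_le hm, ?_⟩
  have := h m T (𝟙 T) (x (n + 1)) (fun z' ↦ by rwa [Subsingleton.elim z' z])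
    (by rw [Category.id_comp]; exact hx _)
  rw [this, Category.id_comp]

end Isolated

/-! ### Points on sections, and finiteness of fibres -/

section Sections

variable {S : Scheme.{u}}

/-- A field-valued point whose image lies on a section factors through that section. -/
lemma eq_comp_section {T : Over S} [IsFieldSpec T] {Z U : Scheme.{u}} (π : Z ⟶ U) [IsSeparated π]
    (σ : U ⟶ Z) (hσ : σ ≫ π = 𝟙 U) (y : T.left ⟶ Z) (t : T.left) (v : U) (h : y t = σ v) :
    y = y ≫ π ≫ σ := by
  obtain ⟨L, _, ⟨e⟩⟩ := IsFieldSpec.exists_iso (T := T)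
  let f : Spec (CommRingCat.of L) ⟶ Z := e.inv ≫ y
  have hf : f (IsLocalRing.closedPoint L) = σ v :=
    (congrArg y (Subsingleton.elim (e.inv (IsLocalRing.closedPoint L)) t)).trans h
  have key : ∀ z : Z, f (IsLocalRing.closedPoint L) = z →
      ∃ ψ : Spec (CommRingCat.of L) ⟶ Spec (Z.residueField z),
        ψ ≫ Z.fromSpecResidueField z = f := by
    rintro _ rfl
    exact ⟨_, Scheme.descResidueField_stalkClosedPointTo_fromSpecResidueField L Z f⟩
  obtain ⟨ψ, hψ⟩ := key _ hf
  have hdom : IsDominant (Spec.map (σ.residueFieldMap v)) :=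
    ⟨fun y ↦ subset_closure ⟨default, Subsingleton.elim _ _⟩⟩
  have h1 : Z.fromSpecResidueField (σ v) = Z.fromSpecResidueField (σ v) ≫ π ≫ σ := by
    refine ext_of_isDominant_of_isSeparated π ?_ (Spec.map (σ.residueFieldMap v)) ?_
    · simp [hσ]
    · rw [Scheme.Hom.SpecMap_residueFieldMap_fromSpecResidueField_assoc,
        Scheme.Hom.SpecMap_residueFieldMap_fromSpecResidueField, reassoc_of% hσ]
  rw [← cancel_epi e.inv]
  change f = f ≫ π ≫ σ
  rw [← hψ, Category.assoc, ← h1]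

variable {G G' : Over S} (p : G' ⟶ G)

/-- The kernel of a finite homomorphism has finitely many points with values in a field. -/
lemma finite_comp_eq [IsFinite p.left] (T : Over S) [IsFieldSpec T] (b : T ⟶ G) :
    {c : T ⟶ G' | c ≫ p = b}.Finite := by
  let π := pullback.snd p.left b.left
  have hfin : Finite (pullback p.left b.left : Scheme.{u}) := by
    obtain ⟨z⟩ : Nonempty T.left := inferInstance
    have := π.finite_preimage_singleton z
    rw [show π ⁻¹' {z} = Set.univ from Set.eq_univ_of_forall fun x ↦ Subsingleton.elim _ _] at this
    exact Set.finite_univ_iff.mp this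
  obtain ⟨z⟩ : Nonempty T.left := inferInstance
  have H (c : {c : T ⟶ G' | c ≫ p = b}) : c.1.left ≫ p.left = 𝟙 _ ≫ b.left := by
    rw [← Over.comp_left, c.2, Category.id_comp]
  let s (c : {c : T ⟶ G' | c ≫ p = b}) : T.left ⟶ pullback p.left b.left :=
    pullback.lift c.1.left (𝟙 _) (H c)
  refine Set.finite_coe_iff.mp ?_
  -- A section over a field is determined by the point it hits, and the fibre has finitely many
  -- points.
  refine Finite.of_injective (fun c ↦ s c z) fun c c' h ↦ ?_
  have h1 := eq_comp_section (T := T) π (s c') (pullback.lift_snd _ _ _) (s c) z z h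
  have h2 : s c ≫ π = 𝟙 _ := pullback.lift_snd _ _ _
  rw [reassoc_of% h2] at h1
  ext : 2
  rw [← pullback.lift_fst (f := p.left) (g := b.left) c.1.left (𝟙 _) (H c),
    ← pullback.lift_fst (f := p.left) (g := b.left) c'.1.left (𝟙 _) (H c')]
  exact congr($h1 ≫ pullback.fst _ _)

end Sections

/-- Translating by an element of a finite normal subgroup does not affect suitable powers. -/
lemma exists_pow_eq_of_mem_finite_normal {Γ : Type*} [Group Γ] (K : Subgroup Γ) [K.Normal]
    [Finite K] (c g : Γ) (hc : c ∈ K) : ∃ n, 0 < n ∧ (c * g) ^ n = g ^ n := by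
  let φ : Γ →* MulAut K := MulAut.conjNormal
  have : Finite (MulAut K) := inferInstance
  -- Conjugation by `g` has finite order on `K`, so `g ^ r` centralizes `K`.
  let r := orderOf (φ g)
  have hr : 0 < r := orderOf_pos _
  have hg : ∀ k ∈ K, Commute k (g ^ r) := by
    intro k hk
    have h : φ (g ^ r) = 1 := by rw [map_pow]; exact pow_orderOf_eq_one _
    have h2 := congr(($h ⟨k, hk⟩ : Γ))
    rw [MulAut.conjNormal_apply] at h2
    have h3 : g ^ r * k = k * g ^ r := by
      rw [mul_inv_eq_iff_eq_mul] at h2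
      exact h2
    exact h3.symm
  have hk : (c * g) ^ r * (g ^ r)⁻¹ ∈ K := by
    rw [← QuotientGroup.eq_one_iff]
    have : (c : Γ ⧸ K) = 1 := (QuotientGroup.eq_one_iff c).mpr hc
    simp [this]
  -- Modulo `K`, `c * g` and `g` agree, so `(c * g) ^ r` is `k * g ^ r` with `k ∈ K`; these factors
  -- commute and the power `Nat.card K` kills `k`.
  refine ⟨r * Nat.card K, Nat.mul_pos hr Nat.card_pos, ?_⟩
  have h : (c * g) ^ r = ((c * g) ^ r * (g ^ r)⁻¹) * g ^ r := by group
  rw [pow_mul, h, (hg _ hk).mul_pow, pow_mul]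
  have := congr((($(pow_card_eq_one' (x := (⟨_, hk⟩ : K))) : K) : Γ))
  rw [SubmonoidClass.mk_pow] at this
  simpa using this

/-! ### Rigidity under the centralizer -/

section Main

variable {κ : Type u} [Field κ] {G G' X U : Over (Spec (CommRingCat.of κ))} [GrpObj G] [GrpObj G']
  [ModObj G X] (p : G' ⟶ G) [IsMonHom p] (j : U ⟶ G') [IsOpenImmersion j.left]
  (f : U ⟶ X) [GeometricallyIntegral G'.hom] [IsSeparated X.hom]

instance isIntegral_tensor (T : Over (Spec (CommRingCat.of κ))) [IsFieldSpec T] :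
    IsIntegral (T ⊗ G').left := by
  have : GeometricallyIntegral (fst T G').left :=
    inferInstanceAs (GeometricallyIntegral (pullback.fst T.hom G'.hom))
  exact GeometricallyIntegral.isIntegral_of_subsingleton (fst T G').left

variable {p j f}

/-- The fixed point `f b` of `p b` is fixed by the centralizer of `b` if it is isolated. -/
lemma smul_eq_of_commute (hf : (j ≫ p) • f = f) {T : Over (Spec (CommRingCat.of κ))} [IsFieldSpec T]
    (b : T ⟶ U) (hb : IsIsolatedFixed (b ≫ j ≫ p) (b ≫ f)) (a : T ⟶ G') (hab : Commute a (b ≫ j)) :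
    (a ≫ p) • (b ≫ f) = b ≫ f := by
  let Y := T ⊗ G'
  -- The conjugate `y b y⁻¹` for variable `y`. `W` is where it lies in `U`; both `y = 1` and `y = a`
  -- belong to `W`, and the conjugate is `b` at each.
  let c : Y ⟶ G' := snd T G' * (fst T G' ≫ b ≫ j) * (snd T G')⁻¹
  obtain ⟨W, i, v, hi, hv, hW⟩ := exists_open_preimage j c
  obtain ⟨w₀, hw₀, hw₀'⟩ := hW T (lift (𝟙 T) 1) b (by simp [c, comp_mul, GrpObj.comp_inv])
  obtain ⟨w₁, hw₁, hw₁'⟩ := hW T (lift (𝟙 T) a) b (by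
    simp [c, comp_mul, GrpObj.comp_inv, hab.eq])
  obtain ⟨z⟩ : Nonempty T.left := inferInstance
  have : Nonempty W.left := ⟨w₀.left z⟩
  have : IsIntegral W.left := isIntegral_of_isOpenImmersion i.left
  let ψ : W ⟶ X := (i ≫ snd T G' ≫ p)⁻¹ • (v ≫ f)
  have hvf : (v ≫ j ≫ p) • (v ≫ f) = v ≫ f := by rw [← ModObj.comp_smul, hf]
  have hψ : ((i ≫ fst T G') ≫ b ≫ j ≫ p) • ψ = ψ := by
    have h1 : v ≫ j ≫ p = (i ≫ snd T G' ≫ p) * (i ≫ fst T G' ≫ b ≫ j ≫ p) *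
        (i ≫ snd T G' ≫ p)⁻¹ := by
      rw [reassoc_of% hv]
      simp [c, comp_mul, mul_comp, GrpObj.comp_inv, GrpObj.inv_comp]
    rw [eq_inv_smul_iff, smul_smul, smul_smul, Category.assoc, ← h1, hvf]
  have key := hb.eq_of_isIntegral (i ≫ fst T G') ψ hψ w₀ (by
    rw [ModObj.comp_smul, GrpObj.comp_inv, Category.assoc, reassoc_of% hw₀, reassoc_of% hw₀',
      reassoc_of% hw₀]
    simp [one_comp])
  have h2 := congr(w₁ ≫ $key)
  rw [ModObj.comp_smul, GrpObj.comp_inv, Category.assoc, reassoc_of% hw₁, reassoc_of% hw₁',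
    reassoc_of% hw₁, inv_smul_eq_iff] at h2
  simpa using h2.symm

end Main

/-! ### Invariance under powers and constancy on fibres -/

section Powers

variable {κ : Type u} [Field κ] {G G' X U : Over (Spec (CommRingCat.of κ))} [GrpObj G]
  [ModObj G X] {p : G' ⟶ G} {j : U ⟶ G'} [IsOpenImmersion j.left] {f : U ⟶ X}

lemma IsIsolatedFixed.of_isDominant [IsIntegral G'.left] {e : genericPt G' ⟶ U}
    (he : e ≫ j = genericPtHom G')
    (hiso : IsIsolatedFixed (e ≫ j ≫ p) (e ≫ f))
    {T : Over (Spec (CommRingCat.of κ))} [IsFieldSpec T] (b : T ⟶ U) [IsDominant (b ≫ j).left] :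
    IsIsolatedFixed (b ≫ j ≫ p) (b ≫ f) := by
  obtain ⟨φ, hφ⟩ := exists_comp_genericPtHom (b ≫ j)
  have : Mono j := Over.mono_of_mono_left j
  obtain rfl : φ ≫ e = b := by rw [← cancel_mono j, Category.assoc, he, hφ]
  simpa using hiso.baseChange φ

variable [GrpObj G']

lemma isDominant_pow (hpow : ∀ n, 0 < n → IsDominant ((𝟙 G' : G' ⟶ G') ^ n).left)
    {T : Over (Spec (CommRingCat.of κ))} (a : T ⟶ G') [IsDominant a.left] {n : ℕ} (hn : 0 < n) :
    IsDominant (a ^ n).left := by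
  have := hpow n hn
  rw [← Category.comp_id a, ← comp_pow]
  exact isDominant_left_comp _ _

variable [IsMonHom p] [Nonempty U.left] [GeometricallyIntegral G'.hom] [IsSeparated X.hom]
  [IsIntegral G'.left]

/-- Along the generic point `f` is unchanged by some power map, of exponent divisible by `M`. -/
lemma exists_pow_comp_eq [LocallyOfFiniteType X.hom] [QuasiCompact X.hom]
    (hpow : ∀ n, 0 < n → IsDominant ((𝟙 G' : G' ⟶ G') ^ n).left) (hf : (j ≫ p) • f = f)
    {e : genericPt G' ⟶ U} (he : e ≫ j = genericPtHom G')
    (hiso : IsIsolatedFixed (e ≫ j ≫ p) (e ≫ f)) {M : ℕ} (hM : 0 < M) :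
    ∃ N, 0 < N ∧ M ∣ N ∧ ∀ (T : Over (Spec (CommRingCat.of κ))) [IsFieldSpec T] (b b' : T ⟶ U),
      IsDominant (b ≫ j).left → b' ≫ j = (b ≫ j) ^ N → b ≫ f = b' ≫ f := by
  have : Mono j := Over.mono_of_mono_left j
  let a := genericPtHom G'
  have hdom : ∀ n, IsDominant (a ^ M ^ n).left := fun n ↦ isDominant_pow hpow a (pow_pos hM n)
  choose v hv using fun n ↦ exists_lift_of_isDominant j (a ^ M ^ n)
  have hisov : ∀ n, IsIsolatedFixed ((a ^ M ^ n) ≫ p) (v n ≫ f) := fun n ↦ by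
    have : IsDominant (v n ≫ j).left := by rw [hv]; exact hdom n
    have := IsIsolatedFixed.of_isDominant he hiso (v n)
    rwa [reassoc_of% hv n] at this
  -- All these values are isolated fixed points of the single element `p(a)`: fixed because `a`
  -- commutes with its powers, isolated because they are so for a power of `p(a)`.
  obtain ⟨m, n, hmn, h⟩ := exists_eq_of_isIsolatedFixed (a ≫ p) (fun n ↦ v n ≫ f)
    (fun n ↦ smul_eq_of_commute hf (v n) (by rw [reassoc_of% hv n]; exact hisov n) a
      (by rw [hv]; exact Commute.self_pow a _))
    (fun n ↦ .of_pow (M ^ n) (by rw [← pow_comp]; exact hisov n))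
  have hN : 0 < M ^ (n - m) := pow_pos hM _
  have := isDominant_pow hpow a hN
  obtain ⟨e', he'⟩ := exists_lift_of_isDominant j (a ^ M ^ (n - m))
  have := hdom m
  -- Since `a ^ M ^ m` is generic, it is the pullback of `a` along some `φ`; cancelling `φ` turns
  -- the coincidence of two powers into one between `a` and its power `M ^ (n - m)`.
  obtain ⟨φ, hφ⟩ := exists_comp_genericPtHom (a ^ M ^ m)
  have h1 : v m = φ ≫ e := by rw [← cancel_mono j, Category.assoc, he, hφ, hv]
  have h2 : v n = φ ≫ e' := by
    rw [← cancel_mono j, Category.assoc, he', hv, comp_pow, hφ, ← pow_mul, ← pow_add]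
    congr 2
    lia
  have := isDominant_of_isFieldSpec φ
  have key : e ≫ f = e' ≫ f := over_ext_of_isDominant φ (by simpa [h1, h2] using h)
  refine ⟨M ^ (n - m), hN, dvd_pow_self _ (by lia), fun T _ b b' hb hb' ↦ ?_⟩
  obtain ⟨ψ, hψ⟩ := exists_comp_genericPtHom (b ≫ j)
  obtain rfl : ψ ≫ e = b := by rw [← cancel_mono j, Category.assoc, he, hψ]
  obtain rfl : ψ ≫ e' = b' := by rw [← cancel_mono j, hb', Category.assoc, he', comp_pow, ← hψ]
  rw [Category.assoc, key, Category.assoc]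

/-- `f` is constant on the fibres of `p`, at points with values in an arbitrary field. -/
lemma comp_eq_of_comp_eq [LocallyOfFiniteType X.hom] [QuasiCompact X.hom] [IsFinite p.left]
    (hpow : ∀ n, 0 < n → IsDominant ((𝟙 G' : G' ⟶ G') ^ n).left) (hf : (j ≫ p) • f = f)
    {e : genericPt G' ⟶ U} (he : e ≫ j = genericPtHom G')
    (hiso : IsIsolatedFixed (e ≫ j ≫ p) (e ≫ f))
    {T : Over (Spec (CommRingCat.of κ))} [IsFieldSpec T] (g₁ g₂ : T ⟶ U)
    (h : g₁ ≫ j ≫ p = g₂ ≫ j ≫ p) : g₁ ≫ f = g₂ ≫ f := by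
  let c : T ⟶ G' := (g₁ ≫ j) * (g₂ ≫ j)⁻¹
  have hc : c ≫ p = 1 := by
    simp [c, mul_comp, GrpObj.inv_comp, h]
  let q : T ⊗ G' ⟶ G' := snd T G'
  let q' : T ⊗ G' ⟶ G' := (fst T G' ≫ c) * q
  have hq : Surjective q.left := by
    have : Surjective T.hom := by
      obtain ⟨z⟩ : Nonempty T.left := inferInstance
      exact ⟨fun y ↦ ⟨z, Subsingleton.elim _ _⟩⟩
    exact inferInstanceAs (Surjective (pullback.snd T.hom G'.hom))
  have hq' : Surjective q'.left := by
    -- Translation by `c` is an automorphism over `T`, so `q'` inherits surjectivity from `q`.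
    let τ : T ⊗ G' ⟶ T ⊗ G' := lift (fst T G') q'
    let τ' : T ⊗ G' ⟶ T ⊗ G' := lift (fst T G') ((fst T G' ≫ c)⁻¹ * q)
    have h1 : τ' ≫ τ = 𝟙 _ := by
      ext1
      · simp [τ, τ']
      · simp [τ, τ', q', q, comp_mul]
    have h2 : τ ≫ τ' = 𝟙 _ := by
      ext1
      · simp [τ, τ']
      · simp [τ, τ', q', q, comp_mul, GrpObj.comp_inv]
    have : IsIso τ := ⟨τ', h2, h1⟩
    have : q' = τ ≫ q := by simp [τ, q]
    have : IsIso τ.left := inferInstanceAs (IsIso ((Over.forget _).map τ))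
    have : Surjective τ.left := inferInstance
    rw [‹q' = τ ≫ q›, Over.comp_left]
    infer_instance
  obtain ⟨W₁, i₁, v₁, hi₁, hv₁, hW₁⟩ := exists_open_preimage j q
  -- `W` is where both `y` and `cy` lie in `U`; it contains `y = g₂`, for which `cy = g₁`.
  obtain ⟨W, i₂, v₂, hi₂, hv₂, hW₂⟩ := exists_open_preimage j (i₁ ≫ q')
  obtain ⟨w₁, hw₁, hw₁'⟩ := hW₁ T (lift (𝟙 T) (g₂ ≫ j)) g₂ (by simp [q])
  obtain ⟨w₂, hw₂, hw₂'⟩ := hW₂ T w₁ g₁ (by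
    rw [reassoc_of% hw₁]
    simp [q', q, c, comp_mul])
  obtain ⟨z⟩ : Nonempty T.left := inferInstance
  have : Nonempty W.left := ⟨w₂.left z⟩
  have : Nonempty W₁.left := ⟨w₁.left z⟩
  have : IsIntegral W₁.left := isIntegral_of_isOpenImmersion i₁.left
  have : IsIntegral W.left := isIntegral_of_isOpenImmersion i₂.left
  let ξ := genericPtHom W
  have hi₁d : IsDominant i₁.left := ⟨i₁.left.isOpenEmbedding.isOpen_range.dense
    (Set.range_nonempty _)⟩
  have hi₂d : IsDominant i₂.left := ⟨i₂.left.isOpenEmbedding.isOpen_range.dense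
    (Set.range_nonempty _)⟩
  let A : genericPt W ⟶ G' := ξ ≫ i₂ ≫ i₁ ≫ q
  let C : genericPt W ⟶ G' := ξ ≫ i₂ ≫ i₁ ≫ fst T G' ≫ c
  have hB : C * A = ξ ≫ i₂ ≫ i₁ ≫ q' := by simp [A, C, q', comp_mul]
  have hAd : IsDominant A.left := by
    simp only [A, ξ, Over.comp_left]; infer_instance
  have hBd : IsDominant (C * A).left := by
    rw [hB]; simp only [ξ, Over.comp_left]; infer_instance
  let K : Subgroup (genericPt W ⟶ G') := (IsMonHom.monoidHom p (genericPt W)).ker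
  have : Finite K := Set.finite_coe_iff.mpr (finite_comp_eq p (genericPt W) 1)
  obtain ⟨M, hM, hCA⟩ := exists_pow_eq_of_mem_finite_normal K C A (by
    rw [MonoidHom.mem_ker]
    change C ≫ p = 1
    simp [C, hc, comp_one])
  -- As `N` is a multiple of `M`, the `N`-th powers of `C * A` and `A` coincide.
  obtain ⟨N, hN, ⟨k, rfl⟩, H⟩ := exists_pow_comp_eq hpow hf he hiso hM
  have := isDominant_pow hpow A hN
  obtain ⟨b', hb'⟩ := exists_lift_of_isDominant j (A ^ (M * k))
  have e₁ : ξ ≫ i₂ ≫ v₁ ≫ j = A := by rw [hv₁]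
  have e₂ : ξ ≫ v₂ ≫ j = C * A := by rw [hv₂, hB]
  have E₁ := H (genericPt W) (ξ ≫ i₂ ≫ v₁) b' (by simpa [e₁]) (by simpa [e₁])
  have E₂ := H (genericPt W) (ξ ≫ v₂) b' (by simpa [e₂]) (by
    simp only [Category.assoc, e₂]
    rw [pow_mul, hCA, ← pow_mul, hb'])
  have key : v₂ ≫ f = i₂ ≫ v₁ ≫ f := over_ext_of_isDominant ξ (by simpa using E₂.trans E₁.symm)
  have := congr(w₂ ≫ $key)
  rwa [reassoc_of% hw₂', reassoc_of% hw₂, reassoc_of% hw₁'] at this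

end Powers

/-! ### Injectivity from the cotangent space -/

section LocalAlgebra

/-- A local endomorphism of a noetherian local ring which acts on the cotangent space as
multiplication by a unit is injective. -/
lemma injective_of_cotangent {A : Type*} [CommRing A] [IsLocalRing A] [IsNoetherianRing A]
    (φ : A →+* A) [IsLocalHom φ] (c : A) (hc : IsUnit c)
    (h : ∀ a ∈ IsLocalRing.maximalIdeal A, φ a - c * a ∈ IsLocalRing.maximalIdeal A ^ 2) :
    Function.Injective φ := by
  let m := IsLocalRing.maximalIdeal A
  have hm : ∀ a ∈ m, φ a ∈ m := fun a ha ↦ by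
    have h1 : φ a = (φ a - c * a) + c * a := by ring
    rw [h1]
    exact m.add_mem (Ideal.pow_le_self two_ne_zero (h a ha)) (m.mul_mem_left c ha)
  -- On the graded piece of degree `i + 1`, `φ` is multiplication by the unit `c ^ (i + 1)`. An
  -- element of the kernel therefore climbs through all powers of `m`, and Krull's intersection
  -- theorem makes it zero.
  have key : ∀ i, ∀ a ∈ m ^ (i + 1), φ a - c ^ (i + 1) * a ∈ m ^ (i + 2) := by
    intro i
    induction i with
    | zero => intro a ha; simpa using h a (by rwa [zero_add, pow_one] at ha)
    | succ i ih =>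
      intro a ha
      rw [pow_succ] at ha
      induction ha using Submodule.mul_induction_on' with
      | mem_mul_mem x hx y hy =>
        have e : φ (x * y) - c ^ (i + 1 + 1) * (x * y) =
            (φ x - c ^ (i + 1) * x) * φ y + (c ^ (i + 1) * x) * (φ y - c * y) := by
          rw [map_mul]; ring
        rw [e]
        refine Ideal.add_mem _ ?_ ?_
        · rw [show i + 1 + 2 = i + 2 + 1 from rfl, pow_succ]
          exact Ideal.mul_mem_mul (ih x hx) (hm y hy)
        · rw [pow_add]
          exact Ideal.mul_mem_mul (Ideal.mul_mem_left _ _ hx) (h y hy)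
      | add x hx y hy hx' hy' =>
        have e : φ (x + y) - c ^ (i + 1 + 1) * (x + y) =
            (φ x - c ^ (i + 1 + 1) * x) + (φ y - c ^ (i + 1 + 1) * y) := by
          rw [map_add]; ring
        rw [e]
        exact Ideal.add_mem _ hx' hy'
  rw [injective_iff_map_eq_zero]
  intro a ha
  have hmem : ∀ i, a ∈ m ^ (i + 1) := by
    intro i
    induction i with
    | zero =>
      rw [zero_add, pow_one, IsLocalRing.mem_maximalIdeal]
      intro hu
      have := hu.map φ
      rw [ha] at this
      exact not_isUnit_zero this
    | succ i ih =>
      have h1 := key i a ih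
      rw [ha, zero_sub, neg_mem_iff] at h1
      exact (Ideal.unit_mul_mem_iff_mem _ (hc.pow (i + 1))).mp h1
  have := Ideal.iInf_pow_eq_bot_of_isLocalRing m (Ideal.IsPrime.ne_top inferInstance)
  rw [← Ideal.mem_bot, ← this, Ideal.mem_iInf]
  intro i
  exact Ideal.pow_le_pow_right (Nat.le_succ i) (hmem i)

end LocalAlgebra

/-! ### The local ring at a rational point -/

section AlgebraPoints

variable {κ : Type u} [Field κ]

/-- The spectrum of a `κ`-algebra, as a `κ`-scheme. -/
noncomputable def algPt (κ : Type u) [Field κ] (R : Type u) [CommRing R] [Algebra κ R] :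
    Over (Spec (CommRingCat.of κ)) :=
  Over.mk (Spec.map (CommRingCat.ofHom (algebraMap κ R)))

/-- The morphism of spectra induced by a homomorphism of `κ`-algebras. -/
noncomputable def algPtMap {R R' : Type u} [CommRing R] [Algebra κ R] [CommRing R'] [Algebra κ R']
    (φ : R →ₐ[κ] R') : algPt κ R' ⟶ algPt κ R :=
  Over.homMk (Spec.map (CommRingCat.ofHom φ.toRingHom)) (by
    change Spec.map _ ≫ Spec.map _ = Spec.map _
    rw [← Spec.map_comp, ← CommRingCat.ofHom_comp]
    congr 2
    exact φ.comp_algebraMap)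

lemma algPtMap_comp {R R' R'' : Type u} [CommRing R] [Algebra κ R] [CommRing R'] [Algebra κ R']
    [CommRing R''] [Algebra κ R''] (φ : R →ₐ[κ] R') (ψ : R' →ₐ[κ] R'') :
    algPtMap ψ ≫ algPtMap φ = algPtMap (ψ.comp φ) := by
  ext1
  change Spec.map _ ≫ Spec.map _ = Spec.map _
  rw [← Spec.map_comp, ← CommRingCat.ofHom_comp]
  rfl

lemma algPtMap_id {R : Type u} [CommRing R] [Algebra κ R] :
    algPtMap (AlgHom.id κ R) = 𝟙 (algPt κ R) := by
  ext1
  exact Spec.map_id _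

/-- The spectrum of the local ring of a scheme at a rational point, with its universal property. -/
lemma exists_local_algPt (G : Over (Spec (CommRingCat.of κ))) [LocallyOfFiniteType G.hom]
    [IrreducibleSpace G.left] (x₀ : algPt κ κ ⟶ G) :
    ∃ (A : Type u) (_ : CommRing A) (_ : Algebra κ A) (_ : IsLocalRing A) (_ : IsNoetherianRing A)
      (a : algPt κ A ⟶ G) (ε : A →ₐ[κ] κ), IsDominant a.left ∧ algPtMap ε ≫ a = x₀ ∧
      (∀ (R : Type u) [CommRing R] [Algebra κ R] (φ ψ : A →ₐ[κ] R),
        algPtMap φ ≫ a = algPtMap ψ ≫ a → φ = ψ) ∧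
      (∀ (R : Type u) [CommRing R] [Algebra κ R] [IsLocalRing R] (π : R →ₐ[κ] κ) (x : algPt κ R ⟶ G),
        algPtMap π ≫ x = x₀ → ∃ φ : A →ₐ[κ] R, IsLocalHom φ ∧ algPtMap φ ≫ a = x) := by
  have : IsLocallyNoetherian G.left := LocallyOfFiniteType.isLocallyNoetherian G.hom
  let e : G.left := x₀.left (IsLocalRing.closedPoint κ)
  let A := G.left.presheaf.stalk e
  obtain ⟨s, hs⟩ := Spec.map_surjective (G.left.fromSpecStalk e ≫ G.hom)
  let _ : Algebra κ A := s.hom.toAlgebra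
  have hs' : s = CommRingCat.ofHom (algebraMap κ A) := rfl
  let a : algPt κ A ⟶ G := Over.homMk (G.left.fromSpecStalk e) hs.symm
  have hmono : Mono (G.left.fromSpecStalk e) := inferInstance
  have hfac : ∀ (R : Type u) [CommRing R] [Algebra κ R] [IsLocalRing R] (x : algPt κ R ⟶ G),
      x.left (IsLocalRing.closedPoint R) = e →
        ∃ φ : A →ₐ[κ] R, IsLocalHom φ ∧ algPtMap φ ≫ a = x := by
    intro R _ _ _ x hx
    have key : ∀ z : G.left, x.left (IsLocalRing.closedPoint R) = z →
        ∃ ψ : G.left.presheaf.stalk z ⟶ CommRingCat.of R,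
          IsLocalHom ψ.hom ∧ Spec.map ψ ≫ G.left.fromSpecStalk z = x.left := by
      rintro _ rfl
      exact ⟨_, Scheme.isLocalHom_stalkClosedPointTo' (X := G.left) (R := R) x.left,
        Scheme.Spec_stalkClosedPointTo_fromSpecStalk (R := CommRingCat.of R) x.left⟩
    obtain ⟨ψ, hψ, hψ'⟩ := key _ hx
    have h1 : s ≫ ψ = CommRingCat.ofHom (algebraMap κ R) := by
      apply Spec.map_injective
      rw [Spec.map_comp, hs, reassoc_of% hψ']
      exact Over.w x
    refine ⟨{ ψ.hom with commutes' := fun r ↦ congr($(h1).hom r) }, ⟨hψ.map_nonunit⟩, ?_⟩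
    ext1
    exact hψ'
  obtain ⟨ε, -, hε⟩ := hfac κ x₀ rfl
  refine ⟨A, inferInstance, inferInstance, inferInstance, inferInstance, a, ε, ?_, hε, ?_, ?_⟩
  · obtain ⟨z, hz⟩ : genericPoint G.left ∈ Set.range (G.left.fromSpecStalk e) := by
      rw [Scheme.range_fromSpecStalk]
      exact genericPoint_specializes e
    exact isDominant_of_apply_eq_genericPoint _ z hz
  · intro R _ _ φ ψ h
    have h1 := congr(($h).left)
    have h2 : Spec.map (CommRingCat.ofHom φ.toRingHom) = Spec.map (CommRingCat.ofHom ψ.toRingHom) :=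
      (cancel_mono (G.left.fromSpecStalk e)).mp h1
    have h3 := Spec.map_injective h2
    ext r
    exact congr($(h3).hom r)
  · intro R _ _ _ π x hx
    refine hfac R x ?_
    have hπ : IsLocalHom π.toRingHom := by
      have : Function.Surjective π.toRingHom := fun r ↦ ⟨algebraMap κ R r, π.commutes r⟩
      exact this.isLocalHom
    have h1 : (algPtMap π).left (IsLocalRing.closedPoint κ) = IsLocalRing.closedPoint R :=
      IsLocalRing.comap_closedPoint π.toRingHom
    exact (congrArg x.left h1).symm.trans congr(($hx).left (IsLocalRing.closedPoint κ))

end AlgebraPoints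

/-! ### Dominance of power maps in characteristic zero -/

section PowerMap

variable {κ : Type u} [Field κ]

instance isLocalRing_trivSqZeroExt (V : Type u) [AddCommGroup V] [Module κ V] [Module κᵐᵒᵖ V]
    [IsCentralScalar κ V] : IsLocalRing (TrivSqZeroExt κ V) := by
  let φ : TrivSqZeroExt κ V →+* κ := (TrivSqZeroExt.fstHom κ κ V).toRingHom
  have : IsLocalHom φ := ⟨fun a ha ↦ TrivSqZeroExt.isUnit_iff_isUnit_fst.mpr ha⟩
  exact RingHom.domain_isLocalRing φ

/-- Multiplication of points with values in the dual numbers that reduce to the unit corresponds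
to addition of tangent vectors. -/
lemma snd_mul_eq_add {G : Over (Spec (CommRingCat.of κ))} [GrpObj G] {A : Type u} [CommRing A]
    [Algebra κ A] (a : algPt κ A ⟶ G)
    (hinj : ∀ (R : Type u) [CommRing R] [Algebra κ R] (φ ψ : A →ₐ[κ] R),
      algPtMap φ ≫ a = algPtMap ψ ≫ a → φ = ψ)
    (hfac : ∀ (R : Type u) [CommRing R] [Algebra κ R] [IsLocalRing R] (π : R →ₐ[κ] κ)
      (x : algPt κ R ⟶ G), algPtMap π ≫ x = 1 →
        ∃ φ : A →ₐ[κ] R, IsLocalHom φ ∧ algPtMap φ ≫ a = x)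
    (φ ψ χ : A →ₐ[κ] TrivSqZeroExt κ κ)
    (hφ : algPtMap (TrivSqZeroExt.fstHom κ κ κ) ≫ algPtMap φ ≫ a = 1)
    (hψ : algPtMap (TrivSqZeroExt.fstHom κ κ κ) ≫ algPtMap ψ ≫ a = 1)
    (hχ : algPtMap χ ≫ a = (algPtMap φ ≫ a) * (algPtMap ψ ≫ a)) (f : A) :
    (χ f).snd = (φ f).snd + (ψ f).snd := by
  let i₁ : TrivSqZeroExt κ κ →ₐ[κ] TrivSqZeroExt κ (κ × κ) :=
    TrivSqZeroExt.map (LinearMap.inl κ κ κ)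
  let i₂ : TrivSqZeroExt κ κ →ₐ[κ] TrivSqZeroExt κ (κ × κ) :=
    TrivSqZeroExt.map (LinearMap.inr κ κ κ)
  let q₁ : TrivSqZeroExt κ (κ × κ) →ₐ[κ] TrivSqZeroExt κ κ :=
    TrivSqZeroExt.map (LinearMap.fst κ κ κ)
  let q₂ : TrivSqZeroExt κ (κ × κ) →ₐ[κ] TrivSqZeroExt κ κ :=
    TrivSqZeroExt.map (LinearMap.snd κ κ κ)
  let s : TrivSqZeroExt κ (κ × κ) →ₐ[κ] TrivSqZeroExt κ κ :=
    TrivSqZeroExt.map (LinearMap.coprod LinearMap.id LinearMap.id)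
  let o : κ →ₐ[κ] TrivSqZeroExt κ κ := TrivSqZeroExt.inlAlgHom κ κ κ
  let t := TrivSqZeroExt.fstHom κ κ κ
  let t₂ := TrivSqZeroExt.fstHom κ κ (κ × κ)
  have e11 : q₁.comp i₁ = AlgHom.id κ _ := by ext <;> simp [q₁, i₁]
  have e22 : q₂.comp i₂ = AlgHom.id κ _ := by ext <;> simp [q₂, i₂]
  have e12 : q₁.comp i₂ = o.comp t := by ext <;> simp [q₁, i₂, o, t]
  have e21 : q₂.comp i₁ = o.comp t := by ext <;> simp [q₂, i₁, o, t]
  have es1 : s.comp i₁ = AlgHom.id κ _ := by ext <;> simp [s, i₁]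
  have es2 : s.comp i₂ = AlgHom.id κ _ := by ext <;> simp [s, i₂]
  have et1 : t₂.comp i₁ = t := by ext; simp [t₂, t, i₁]
  have et2 : t₂.comp i₂ = t := by ext; simp [t₂, t, i₂]
  let x := algPtMap φ ≫ a
  let y := algPtMap ψ ≫ a
  -- This point has two independent infinitesimals: `q₁` and `q₂` recover `x` and `y`, while setting
  -- both equal through `s` gives their product. Linearity of the tangent coordinates then gives
  -- additivity.
  let z : algPt κ (TrivSqZeroExt κ (κ × κ)) ⟶ G := (algPtMap i₁ ≫ x) * (algPtMap i₂ ≫ y)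
  have hz : ∀ (R : Type u) [CommRing R] [Algebra κ R] (r : TrivSqZeroExt κ (κ × κ) →ₐ[κ] R),
      algPtMap r ≫ z = (algPtMap (r.comp i₁) ≫ x) * (algPtMap (r.comp i₂) ≫ y) := by
    intro R _ _ r
    simp only [z, comp_mul, ← algPtMap_comp, Category.assoc]
  have hx1 : algPtMap (o.comp t) ≫ x = 1 := by
    rw [← algPtMap_comp, Category.assoc, hφ, comp_one]
  have hy1 : algPtMap (o.comp t) ≫ y = 1 := by
    rw [← algPtMap_comp, Category.assoc, hψ, comp_one]
  obtain ⟨ζ, -, hζ⟩ := hfac _ t₂ z (by rw [hz, et1, et2, hφ, hψ, _root_.mul_one])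
  have h1 : q₁.comp ζ = φ := hinj _ _ _ (by
    rw [← algPtMap_comp, Category.assoc, hζ, hz, e11, e12, hy1, _root_.mul_one, algPtMap_id,
      Category.id_comp])
  have h2 : q₂.comp ζ = ψ := hinj _ _ _ (by
    rw [← algPtMap_comp, Category.assoc, hζ, hz, e22, e21, hx1, _root_.one_mul, algPtMap_id,
      Category.id_comp])
  have h3 : s.comp ζ = χ := hinj _ _ _ (by
    rw [← algPtMap_comp, Category.assoc, hζ, hz, es1, es2, algPtMap_id, Category.id_comp,
      Category.id_comp, hχ])
  rw [← h1, ← h2, ← h3]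
  simp [s, q₁, q₂]

/-- The tangent vector at the unit with given coordinates, as a homomorphism to the dual numbers. -/
lemma exists_algHom_trivSqZeroExt {A : Type u} [CommRing A] [Algebra κ A] [IsLocalRing A]
    (ε : A →ₐ[κ] κ) (g : A) (hg : g ∈ IsLocalRing.maximalIdeal A)
    (hg2 : g ∉ IsLocalRing.maximalIdeal A ^ 2) :
    ∃ D : A →ₐ[κ] TrivSqZeroExt κ κ, (TrivSqZeroExt.fstHom κ κ κ).comp D = ε ∧ (D g).snd ≠ 0 := by
  let m := IsLocalRing.maximalIdeal A
  have hsurj : Function.Surjective ε := fun r ↦ ⟨algebraMap κ A r, by simp⟩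
  have hm : RingHom.ker ε = m := by
    have := RingHom.ker_isMaximal_of_surjective ε hsurj
    exact IsLocalRing.eq_maximalIdeal this
  have hmem : ∀ f : A, f - algebraMap κ A (ε f) ∈ m := fun f ↦ by
    rw [← hm, RingHom.mem_ker]; simp
  let d : A →ₗ[κ] A ⧸ m ^ 2 := (Ideal.Quotient.mkₐ κ (m ^ 2)).toLinearMap
  have hd : ∀ f, d f = 0 ↔ f ∈ m ^ 2 := fun f ↦ Ideal.Quotient.eq_zero_iff_mem
  obtain ⟨l, hl⟩ : ∃ l : Module.Dual κ (A ⧸ m ^ 2), l (d g) ≠ 0 := by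
    by_contra! h
    exact hg2 ((hd g).mp ((Module.forall_dual_apply_eq_zero_iff κ _).mp h))
  -- A functional on the cotangent space, extended to a derivation at the unit by first removing the
  -- constant term.
  let δ : A →ₗ[κ] κ := l ∘ₗ d ∘ₗ (LinearMap.id - (Algebra.linearMap κ A) ∘ₗ ε.toLinearMap)
  have hδ : ∀ f, δ f = l (d (f - algebraMap κ A (ε f))) := fun f ↦ rfl
  have hmul : ∀ f h, δ (f * h) = ε f * δ h + ε h * δ f := by
    intro f h
    simp only [hδ, ← smul_eq_mul, ← map_smul, ← map_add]
    rw [← sub_eq_zero, ← map_sub, ← map_sub]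
    rw [(hd _).mpr, map_zero]
    have : f * h - algebraMap κ A (ε (f * h)) -
        (ε f • (h - algebraMap κ A (ε h)) + ε h • (f - algebraMap κ A (ε f))) =
        (f - algebraMap κ A (ε f)) * (h - algebraMap κ A (ε h)) := by
      simp only [Algebra.smul_def, map_mul]; ring
    simp only [smul_eq_mul]
    rw [this, pow_two]
    exact Ideal.mul_mem_mul (hmem f) (hmem h)
  refine ⟨AlgHom.ofLinearMap
    { toFun := fun f ↦ TrivSqZeroExt.inl (ε f) + TrivSqZeroExt.inr (δ f)
      map_add' := fun f h ↦ by ext <;> simp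
      map_smul' := fun r f ↦ by ext <;> simp } ?_ ?_, ?_, ?_⟩
  · ext <;> simp [hδ]
  · intro f h
    ext
    · simp
    · simp [hmul, mul_comm]
  · ext f; simp
  · have : ε g = 0 := by rwa [← RingHom.mem_ker, hm]
    simpa [hδ, this] using hl

/-- In characteristic zero the power maps of a connected algebraic group are dominant. -/
lemma isDominant_id_pow [CharZero κ] (G : Over (Spec (CommRingCat.of κ))) [GrpObj G]
    [LocallyOfFiniteType G.hom] [IrreducibleSpace G.left] (n : ℕ) (hn : 0 < n) :
    IsDominant ((𝟙 G : G ⟶ G) ^ n).left := by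
  obtain ⟨A, _, _, _, _, a, ε, hdom, hε, hinj, hfac⟩ := exists_local_algPt G (1 : algPt κ κ ⟶ G)
  have hpow : ∀ n, algPtMap ε ≫ (a ^ n) = 1 := fun n ↦ by rw [comp_pow, hε, one_pow]
  obtain ⟨φ, hφ, hφa⟩ := hfac A ε (a ^ n) (hpow n)
  have hker : ∀ g ∈ IsLocalRing.maximalIdeal A, ε g = 0 := fun g hg ↦ by
    have hsurj : Function.Surjective ε := fun r ↦ ⟨algebraMap κ A r, by simp⟩
    have := RingHom.ker_isMaximal_of_surjective ε hsurj
    rwa [← RingHom.mem_ker, IsLocalRing.eq_maximalIdeal this]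
  have hcot : ∀ g ∈ IsLocalRing.maximalIdeal A,
      φ g - (n : A) * g ∈ IsLocalRing.maximalIdeal A ^ 2 := by
    intro g hg
    by_contra hcon
    have hloc : IsLocalHom φ.toRingHom := ⟨hφ.map_nonunit⟩
    have hmem : φ g - (n : A) * g ∈ IsLocalRing.maximalIdeal A :=
      sub_mem ((IsLocalRing.maximalIdeal_comap φ.toRingHom).ge hg) (Ideal.mul_mem_left _ _ hg)
    obtain ⟨D, hD, hD'⟩ := exists_algHom_trivSqZeroExt ε _ hmem hcon
    refine hD' ?_
    have hred : ∀ k, algPtMap (TrivSqZeroExt.fstHom κ κ κ) ≫ (algPtMap D ≫ a) ^ k = 1 := by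
      intro k
      rw [comp_pow, ← Category.assoc, algPtMap_comp, hD, hε, one_pow]
    -- Powers of a tangent vector at the unit are its multiples. Hence every `D` kills `φ g - n *
    -- g`, against the choice of `D`.
    have key : ∀ (k : ℕ) (χ : A →ₐ[κ] TrivSqZeroExt κ κ), algPtMap χ ≫ a = (algPtMap D ≫ a) ^ (k + 1) →
        (χ g).snd = (k + 1) * (D g).snd := by
      intro k
      induction k with
      | zero =>
        intro χ hχ
        rw [zero_add, pow_one] at hχ
        rw [hinj _ _ _ hχ]
        simp
      | succ k ih =>
        intro χ hχ
        obtain ⟨ψ, -, hψ⟩ := hfac _ (TrivSqZeroExt.fstHom κ κ κ) _ (hred (k + 1))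
        rw [snd_mul_eq_add a hinj hfac ψ D χ (by rw [hψ, hred])
          (by simpa using hred 1) (by rw [hχ, hψ, pow_succ]), ih ψ hψ]
        push_cast
        ring
    obtain ⟨k, rfl⟩ : ∃ k, n = k + 1 := ⟨n - 1, by lia⟩
    have h := key k (D.comp φ) (by rw [← algPtMap_comp, Category.assoc, hφa, comp_pow])
    have hn' : D ((k + 1 : ℕ) : A) = ((k + 1 : ℕ) : TrivSqZeroExt κ κ) := map_natCast D _
    have hDg : (D g).fst = 0 := by
      have := congr($hD g)
      rw [hker g hg] at this
      exact this
    rw [map_sub, map_mul, hn', TrivSqZeroExt.snd_sub, sub_eq_zero]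
    have h' : (D (φ g)).snd = (k + 1) * (D g).snd := h
    rw [h', ← nsmul_eq_mul, TrivSqZeroExt.snd_smul, nsmul_eq_mul]
    push_cast
    rfl
  have hunit : IsUnit (n : A) := by
    have : IsUnit (n : κ) := by rw [isUnit_iff_ne_zero]; exact_mod_cast hn.ne'
    simpa using this.map (algebraMap κ A)
  have hloc : IsLocalHom φ.toRingHom := ⟨hφ.map_nonunit⟩
  have hφinj : Function.Injective φ.toRingHom := injective_of_cotangent φ.toRingHom n hunit hcot
  have hφd : IsDominant (algPtMap φ).left := by
    refine ⟨PrimeSpectrum.denseRange_comap_iff_ker_le_nilRadical (f := φ.toRingHom) |>.mpr ?_⟩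
    rw [(RingHom.injective_iff_ker_eq_bot _).mp hφinj]
    exact bot_le
  have h1 : IsDominant (a ≫ (𝟙 G) ^ n).left := by
    rw [comp_pow, Category.comp_id, ← hφa, Over.comp_left]
    infer_instance
  rw [Over.comp_left] at h1
  exact IsDominant.of_comp a.left _

end PowerMap

/-! ### Quasi-finiteness of the fixed-point scheme -/

lemma discreteTopology_of_finite_closedPoints {F : Type*} [TopologicalSpace F] [JacobsonSpace F]
    (h : (closedPoints F).Finite) : DiscreteTopology F := by
  have hc : IsClosed (closedPoints F) := by
    rw [← Set.biUnion_of_singleton (closedPoints F)]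
    exact h.isClosed_biUnion fun x hx ↦ hx
  have hu : closedPoints F = Set.univ := by rw [← hc.closure_eq, closure_closedPoints]
  have : Finite F := Set.finite_univ_iff.mp (hu ▸ h)
  have : T1Space F := ⟨fun x ↦ (hu ▸ Set.mem_univ x : x ∈ closedPoints F)⟩
  infer_instance

lemma locallyOfFiniteType_fiberToSpecResidueField {Z U : Scheme.{u}} (π : Z ⟶ U)
    [LocallyOfFiniteType π] (v : U) : LocallyOfFiniteType (π.fiberToSpecResidueField v) := by
  have h : IsPullback (π.fiberι v) (π.fiberToSpecResidueField v) π (U.fromSpecResidueField v) :=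
    IsPullback.of_hasPullback π (U.fromSpecResidueField v)
  exact MorphismProperty.of_isPullback h ‹_›

lemma exists_eq_comp_fromSpecResidueField {Ω : Type u} [Field Ω] {U : Scheme.{u}}
    (u : Spec (CommRingCat.of Ω) ⟶ U) (a : Spec (CommRingCat.of Ω)) (v : U) (h : u a = v) :
    ∃ ω : Spec (CommRingCat.of Ω) ⟶ Spec (U.residueField v),
      ω ≫ U.fromSpecResidueField v = u := by
  subst h
  obtain rfl : a = IsLocalRing.closedPoint Ω := Subsingleton.elim _ _
  exact ⟨_, Scheme.descResidueField_stalkClosedPointTo_fromSpecResidueField Ω U u⟩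

section

variable {κ : Type u} [Field κ]

/-- If only finitely many geometric points lie above a given geometric point, then the morphism
is quasi-finite there. -/
lemma quasiFiniteAt_of_finite {Z U : Over (Spec (CommRingCat.of κ))} (π : Z ⟶ U)
    [LocallyOfFiniteType π.left] (u₀ : geomPt κ ⟶ U) (a : (geomPt κ).left)
    (hfin : {z : geomPt κ ⟶ Z | z ≫ π = u₀}.Finite) (z : Z.left) (hz : u₀.left a = π.left z) :
    π.left.QuasiFiniteAt z := by
  obtain ⟨ω, hω⟩ := exists_eq_comp_fromSpecResidueField (Ω := AlgebraicClosure κ) u₀.left a _ hz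
  have := locallyOfFiniteType_fiberToSpecResidueField π.left (π.left z)
  -- Each closed point of the fibre carries a geometric point above `u₀`, and different closed
  -- points need different ones. So the fibre has finitely many closed points and is discrete.
  have key : ∀ x : closedPoints (π.left.fiber (π.left z)), ∃ y : geomPt κ ⟶ Z,
      y ≫ π = u₀ ∧ y.left a = π.left.fiberι (π.left z) x.1 := by
    intro x
    obtain ⟨φ, hφ⟩ := @exists_point_of_isClosed (U.left.residueField (π.left z))
      (AlgebraicClosure κ) _ _ _ ω _ (π.left.fiberToSpecResidueField (π.left z)) this x.1 x.2
    obtain ⟨m, hm, hm'⟩ : ∃ m : Spec (CommRingCat.of (AlgebraicClosure κ)) ⟶ Z.left,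
        m a = π.left.fiberι (π.left z) x.1 ∧ m ≫ π.left = u₀.left := by
      refine ⟨φ ≫ (π.left.fiber (π.left z)).fromSpecResidueField x.1 ≫
        π.left.fiberι (π.left z), ?_, ?_⟩
      · change π.left.fiberι _ ((π.left.fiber (π.left z)).fromSpecResidueField x.1 (φ a)) = _
        rw [Scheme.fromSpecResidueField_apply]
      · rw [← hω, ← hφ]
        simp only [Category.assoc]
        rw [Scheme.Hom.fiber_fac]
    have hw : m ≫ Z.hom = (geomPt κ).hom := by
      rw [← Over.w π, ← Category.assoc, hm']
      exact Over.w u₀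
    exact ⟨Over.homMk m hw, Over.OverMorphism.ext hm', hm⟩
  choose c hc hc' using key
  have hF : (closedPoints (π.left.fiber (π.left z))).Finite := by
    have := hfin.to_subtype
    have hinj : Function.Injective fun x ↦
        (⟨c x, hc x⟩ : {z : geomPt κ ⟶ Z | z ≫ π = u₀}) := by
      intro x y hxy
      refine Subtype.ext ((π.left.fiberι (π.left z)).isEmbedding.injective ?_)
      rw [← hc', ← hc', show c x = c y from congrArg Subtype.val hxy]
    exact Set.finite_coe_iff.mp (Finite.of_injective _ hinj)
  have := discreteTopology_of_finite_closedPoints hF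
  rw [Scheme.Hom.quasiFiniteAt_iff_isOpen_singleton_asFiber]
  exact isOpen_discrete _

/-- An isolated point of a fibre is the only point of that fibre in some open set. -/
lemma exists_open_of_quasiFiniteAt {Z U : Scheme.{u}} (π : Z ⟶ U) [LocallyOfFiniteType π] (z : Z)
    (h : π.QuasiFiniteAt z) :
    ∃ O : Z.Opens, z ∈ O ∧ ∀ y ∈ O, π y = π z → y = z := by
  rw [Scheme.Hom.quasiFiniteAt_iff_isOpen_singleton_asFiber,
    (π.fiberι (π z)).isEmbedding.isOpen_iff] at h
  obtain ⟨O, hO, hO'⟩ := h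
  refine ⟨⟨O, hO⟩, ?_, fun y hy hyz ↦ ?_⟩
  · have : π.asFiber z ∈ π.fiberι (π z) ⁻¹' O := hO' ▸ rfl
    simpa using this
  · obtain ⟨y, rfl⟩ : y ∈ Set.range (π.fiberι (π z)) := by rw [Scheme.Hom.range_fiberι]; exact hyz
    have : y ∈ ({π.asFiber z} : Set _) := hO' ▸ hy
    rw [this, Scheme.Hom.fiberι_asFiber]

/-- If some element of the family `γ` has finitely many fixed points, then any fixed point of the
generic element of the family that depends rationally on it is isolated. -/
lemma isIsolatedFixed_of_finite {G X U T : Over (Spec (CommRingCat.of κ))} [GrpObj G] [ModObj G X]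
    [LocallyOfFiniteType X.hom] [IsSeparated X.hom] [IsIntegral U.left] (g : U ⟶ G) (f : U ⟶ X)
    (hf : g • f = f) (u₀ : geomPt κ ⟶ U) (hfin : (fixedPoints X (u₀ ≫ g)).Finite)
    [IsFieldSpec T] (e : T ⟶ U) [IsDominant e.left] :
    IsIsolatedFixed (e ≫ g) (e ≫ f) := by
  -- The equalizer of `r` and the projection is the scheme of pairs (element, fixed point).
  let r : U ⊗ X ⟶ X := (fst U X ≫ g) • snd U X
  let i := equalizer.ι r (snd U X)
  let π := i ≫ fst U X
  have hr {E : Over (Spec (CommRingCat.of κ))} (t : E ⟶ U) (y : E ⟶ X) :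
      lift t y ≫ r = (t ≫ g) • y := by
    rw [ModObj.comp_smul, ← Category.assoc, lift_fst, lift_snd]
  let σ : U ⟶ equalizer r (snd U X) := equalizer.lift (lift (𝟙 U) f) (by
    rw [hr, lift_snd, Category.id_comp, hf])
  have hσi : σ ≫ i = lift (𝟙 U) f := equalizer.lift_ι _ _
  have hσ : σ ≫ π = 𝟙 U := by rw [← Category.assoc, hσi, lift_fst]
  have hσl : σ.left ≫ π.left = 𝟙 U.left := congr(($hσ).left)
  have hσπ (u : U.left) : π.left (σ.left u) = u := by
    rw [← Scheme.Hom.comp_apply, hσl]; rfl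
  have hlift {E : Over (Spec (CommRingCat.of κ))} (z : E ⟶ equalizer r (snd U X)) (t : E ⟶ U)
      (hz : z ≫ π = t) : z ≫ i = lift t (z ≫ i ≫ snd U X) := by
    subst hz
    ext1 <;> simp [π]
  have : IsClosedImmersion i.left := inferInstance
  have : LocallyOfFiniteType (fst U X).left :=
    inferInstanceAs (LocallyOfFiniteType (pullback.fst U.hom X.hom))
  have : IsSeparated (fst U X).left :=
    inferInstanceAs (IsSeparated (pullback.fst U.hom X.hom))
  have : LocallyOfFiniteType π.left := inferInstanceAs (LocallyOfFiniteType (i.left ≫ _))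
  have : IsSeparated π.left := inferInstanceAs (IsSeparated (i.left ≫ _))
  obtain ⟨a⟩ : Nonempty (geomPt κ).left := inferInstance
  have hq : π.left.QuasiFiniteAt (σ.left (u₀.left a)) := by
    refine quasiFiniteAt_of_finite π u₀ a ?_ _ (hσπ _).symm
    refine Set.Finite.of_injOn (f := fun z ↦ z ≫ i ≫ snd U X) (t := fixedPoints X (u₀ ≫ g))
      ?_ ?_ hfin
    · intro z hz
      exact (hr u₀ (z ≫ i ≫ snd U X)).symm.trans (by
        rw [← hlift z u₀ hz, Category.assoc, equalizer.condition])
    · intro z hz z' hz' h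
      rw [← cancel_mono i, hlift z u₀ hz, hlift z' u₀ hz', show z ≫ i ≫ snd U X = _ from h]
  obtain ⟨b⟩ : Nonempty T.left := inferInstance
  -- The quasi-finite locus is open and meets the section over `u₀`, so it contains the section over
  -- the generic point.
  have hgen : π.left.QuasiFiniteAt (σ.left (e.left b)) := by
    have ho : IsOpen (σ.left ⁻¹' {x | π.left.QuasiFiniteAt x}) :=
      π.left.isOpen_quasiFiniteAt.preimage σ.left.continuous
    rw [apply_eq_genericPoint e.left b]
    exact ((genericPoint_spec U.left).mem_open_set_iff ho).mpr ⟨_, trivial, hq⟩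
  obtain ⟨O, hO, hO'⟩ := exists_open_of_quasiFiniteAt π.left _ hgen
  obtain ⟨O₁, rfl⟩ : ∃ O₁ : (U ⊗ X).left.Opens, O = i.left ⁻¹ᵁ O₁ := by
    obtain ⟨O₁, hO₁, h⟩ := i.left.isClosedEmbedding.isInducing.isOpen_iff.mp O.2
    exact ⟨⟨O₁, hO₁⟩, Opens.ext h.symm⟩
  have hO₁ {E : Over (Spec (CommRingCat.of κ))} (t : E ⟶ T) (y : E ⟶ X)
      (y' : E ⟶ equalizer r (snd U X)) (h : y' ≫ i = lift (t ≫ e) y) (c : E.left) :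
      (e ▷ X).left ((lift t y).left c) = i.left (y'.left c) := by
    rw [← Scheme.Hom.comp_apply, ← Scheme.Hom.comp_apply, ← Over.comp_left, ← Over.comp_left, h,
      lift_whiskerRight]
  refine ⟨(e ▷ X).left ⁻¹ᵁ O₁, fun z ↦ ?_, fun E _ t y hy hfix ↦ ?_⟩
  · change (e ▷ X).left _ ∈ O₁
    rw [hO₁ (𝟙 T) (e ≫ f) (e ≫ σ) (by rw [Category.assoc, hσi]; ext1 <;> simp), Over.comp_left,
      Scheme.Hom.comp_apply, Subsingleton.elim z b]
    exact hO
  · let y' : E ⟶ equalizer r (snd U X) := equalizer.lift (lift (t ≫ e) y) (by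
      rw [hr, lift_snd, Category.assoc, hfix])
    have hy'i : y' ≫ i = lift (t ≫ e) y := equalizer.lift_ι _ _
    have hy'π : y' ≫ π = t ≫ e := by rw [← Category.assoc, hy'i, lift_fst]
    obtain ⟨c⟩ : Nonempty E.left := inferInstance
    -- Isolation is so far topological; `eq_comp_section` upgrades it to equality of field-valued
    -- points.
    have hc : y'.left c = σ.left (e.left b) := by
      refine hO' _ ?_ ?_
      · change i.left _ ∈ O₁
        rw [← hO₁ t y y' hy'i]
        exact hy c
      · rw [hσπ, ← Scheme.Hom.comp_apply, ← Over.comp_left, hy'π, Over.comp_left,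
          Scheme.Hom.comp_apply, Subsingleton.elim (t.left c) b]
    have h : y' = t ≫ e ≫ σ := by
      rw [← Category.assoc, ← hy'π, Category.assoc]
      exact Over.OverMorphism.ext (eq_comp_section π.left σ.left hσl y'.left c _ hc)
    calc y = y' ≫ i ≫ snd U X := by rw [← Category.assoc, hy'i, lift_snd]
      _ = t ≫ e ≫ f := by
        rw [h, Category.assoc, Category.assoc, ← Category.assoc σ, hσi, lift_snd]

end

/-! ### Descent along separable extensions -/

section Descent

variable {K K' : Type u} [Field K] [Field K'] [Algebra K K']

/-- An element of a separable algebraic extension that has only one conjugate lies in the base. -/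
lemma mem_range_algebraMap_of_forall_algHom [Algebra.IsSeparable K K'] (a : K')
    (h : ∀ σ τ : K' →ₐ[K] AlgebraicClosure K', σ a = τ a) : a ∈ (algebraMap K K').range := by
  -- The minimal polynomial is separable with a single root, hence of degree one.
  have : (_root_.minpoly K a).rootSet (AlgebraicClosure K') =
      {algebraMap K' (AlgebraicClosure K') a} := by
    rw [← Algebra.IsAlgebraic.range_eval_eq_rootSet_minpoly]
    ext b
    constructor
    · rintro ⟨σ, rfl⟩
      exact h σ (IsScalarTower.toAlgHom K K' (AlgebraicClosure K'))
    · rintro rfl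
      exact ⟨IsScalarTower.toAlgHom K K' (AlgebraicClosure K'), rfl⟩
  rw [← minpoly.natDegree_eq_one_iff, ← Polynomial.card_rootSet_eq_natDegree
    (K := AlgebraicClosure K') (Algebra.IsSeparable.isSeparable K a) (IsAlgClosed.splits _),
    ← Nat.card_eq_fintype_card, this, Nat.card_unique]

/-- A morphism from the spectrum of a separable algebraic extension descends to the base field if
it does not distinguish conjugate geometric points. -/
lemma exists_descent_of_forall_algHom [Algebra.IsSeparable K K'] {X : Scheme.{u}}
    (x : Spec (CommRingCat.of K') ⟶ X)
    (h : ∀ σ τ : K' →ₐ[K] AlgebraicClosure K',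
      Spec.map (CommRingCat.ofHom σ.toRingHom) ≫ x = Spec.map (CommRingCat.ofHom τ.toRingHom) ≫ x) :
    ∃ y : Spec (CommRingCat.of K) ⟶ X,
      Spec.map (CommRingCat.ofHom (algebraMap K K')) ≫ y = x := by
  obtain ⟨z, ω, hω⟩ : ∃ (z : X) (ω : Spec (CommRingCat.of K') ⟶ Spec (X.residueField z)),
      ω ≫ X.fromSpecResidueField z = x :=
    ⟨_, exists_eq_comp_fromSpecResidueField x (IsLocalRing.closedPoint K') _ rfl⟩
  obtain ⟨φ, rfl⟩ := Spec.map_surjective ω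
  have hφ (a) : φ.hom a ∈ (algebraMap K K').range := by
    refine mem_range_algebraMap_of_forall_algHom _ fun σ τ ↦ ?_
    have := h σ τ
    rw [← hω, ← Category.assoc, ← Category.assoc, cancel_mono, ← Spec.map_comp,
      ← Spec.map_comp, Spec.map_inj] at this
    exact congr(($this).hom a)
  choose ψ hψ using hφ
  have hinj := (algebraMap K K').injective
  let ψ' : X.residueField z →+* K :=
    { toFun := ψ
      map_one' := hinj (by rw [hψ]; simp)
      map_mul' := fun a b ↦ hinj (by simp [hψ])
      map_zero' := hinj (by rw [hψ]; simp)
      map_add' := fun a b ↦ hinj (by simp [hψ]) }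
  refine ⟨Spec.map (CommRingCat.ofHom ψ') ≫ X.fromSpecResidueField _, ?_⟩
  rw [← hω, ← Category.assoc, ← Spec.map_comp]
  congr 2
  ext a
  exact hψ a

end Descent

/-! ### Generic points under finite morphisms and composition -/

lemma isDominant_of_comp_isOpenImmersion {S : Scheme.{u}} {T U Y : Over S} [IsFieldSpec T]
    [IsIntegral U.left] [IsIntegral Y.left] (e : T ⟶ U) (j : U ⟶ Y) [IsOpenImmersion j.left]
    [IsDominant (e ≫ j).left] : IsDominant e.left := by
  obtain ⟨b⟩ : Nonempty T.left := inferInstance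
  refine isDominant_of_apply_eq_genericPoint e.left b (j.left.isOpenEmbedding.injective ?_)
  rw [genericPoint_eq_of_isOpenImmersion, ← apply_eq_genericPoint (e ≫ j).left b]
  rfl

/-- The morphism of generic points induced by a finite morphism is finite. -/
lemma isFinite_of_genericPtHom_comp {S : Scheme.{u}} {Y' Y : Over S} [IsIntegral Y'.left]
    [IsIntegral Y.left] (p : Y' ⟶ Y) [IsFinite p.left] (q : genericPt Y' ⟶ genericPt Y)
    (hq : q ≫ genericPtHom Y = genericPtHom Y' ≫ p) : IsFinite q.left := by
  have hl : q.left ≫ (genericPtHom Y).left = (genericPtHom Y').left ≫ p.left := congr(($hq).left)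
  let s : (genericPt Y').left ⟶ pullback p.left (genericPtHom Y).left :=
    pullback.lift (genericPtHom Y').left q.left hl.symm
  have hs : s ≫ pullback.fst _ _ = (genericPtHom Y').left := pullback.lift_fst _ _ _
  have hs' : s ≫ pullback.snd _ _ = q.left := pullback.lift_snd _ _ _
  have : IsPreimmersion (genericPtHom Y).left :=
    inferInstanceAs (IsPreimmersion (Y.left.fromSpecStalk (genericPoint Y.left)))
  have : IsPreimmersion (genericPtHom Y').left :=
    inferInstanceAs (IsPreimmersion (Y'.left.fromSpecStalk (genericPoint Y'.left)))
  have : IsPreimmersion (s ≫ pullback.fst p.left (genericPtHom Y).left) := by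
    rwa [hs]
  have : IsPreimmersion s := .of_comp s (pullback.fst _ _)
  -- The generic fibre of a finite morphism is discrete, so the preimmersion `s` into it is closed
  -- and `q` is finite.
  have : DiscreteTopology ↑(pullback p.left (genericPtHom Y).left) := by
    obtain ⟨a⟩ : Nonempty (genericPt Y).left := inferInstance
    rw [← isDiscrete_univ_iff]
    have h := (pullback.snd p.left (genericPtHom Y).left).isDiscrete_preimage_singleton a
    convert h
    ext z
    simp only [Set.mem_univ, Set.mem_preimage, Set.mem_singleton_iff, true_iff]
    exact Subsingleton.elim _ _
  have : IsClosedImmersion s := .of_isPreimmersion s (isClosed_discrete _)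
  rw [← hs']
  infer_instance

/-- In characteristic zero, a field-valued point that does not distinguish points with the same image
under a finite morphism descends along that morphism. -/
lemma exists_descent_of_isFinite {κ : Type u} [Field κ] [CharZero κ]
    {T' T X : Over (Spec (CommRingCat.of κ))} [IsFieldSpec T'] [IsFieldSpec T] (q : T' ⟶ T)
    [IsFinite q.left] (x : T' ⟶ X)
    (h : ∀ (E : Over (Spec (CommRingCat.of κ))) [IsFieldSpec E] (s t : E ⟶ T'),
      s ≫ q = t ≫ q → s ≫ x = t ≫ x) : ∃ y : T ⟶ X, q ≫ y = x := by
  obtain ⟨K, _, ⟨i⟩⟩ := IsFieldSpec.exists_iso (T := T)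
  obtain ⟨K', _, ⟨i'⟩⟩ := IsFieldSpec.exists_iso (T := T')
  obtain ⟨φ, hφ⟩ := Spec.map_surjective (i'.inv ≫ q.left ≫ i.hom)
  obtain ⟨c, hc⟩ := Spec.map_surjective (i.inv ≫ T.hom)
  have hfin : IsFinite (Spec.map φ) := by rw [hφ]; infer_instance
  rw [IsFinite.SpecMap_iff] at hfin
  have : CharZero K := charZero_of_injective_ringHom c.hom.injective
  algebraize [φ.hom]
  have : Module.Finite K K' := hfin
  have hq : i'.inv ≫ q.left = Spec.map φ ≫ i.inv := by
    rw [hφ, Category.assoc, Category.assoc, Iso.hom_inv_id, Category.comp_id]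
  have key (ρ : K' →ₐ[K] AlgebraicClosure K') :
      (Spec.map (CommRingCat.ofHom ρ.toRingHom) ≫ i'.inv) ≫ q.left =
        Spec.map (CommRingCat.ofHom (algebraMap K (AlgebraicClosure K'))) ≫ i.inv := by
    rw [Category.assoc, hq, ← Category.assoc, ← Spec.map_comp]
    congr 2
    ext a
    exact ρ.commutes a
  -- All `K`-embeddings of `K'` in its algebraic closure become points of `T'` with the same image
  -- in `T`, which is where `h` applies.
  let E : Over (Spec (CommRingCat.of κ)) := Over.mk
    (Spec.map (CommRingCat.ofHom (algebraMap K (AlgebraicClosure K'))) ≫ i.inv ≫ T.hom)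
  let s (ρ : K' →ₐ[K] AlgebraicClosure K') : E ⟶ T' :=
    Over.homMk (Spec.map (CommRingCat.ofHom ρ.toRingHom) ≫ i'.inv) (by
      rw [← Over.w q, ← Category.assoc, key, Category.assoc]; rfl)
  obtain ⟨y, hy⟩ := exists_descent_of_forall_algHom (K := K) (i'.inv ≫ x.left) fun σ τ ↦ by
    have hs : s σ ≫ q = s τ ≫ q := Over.OverMorphism.ext ((key σ).trans (key τ).symm)
    exact (Category.assoc _ _ _).symm.trans
      (congr(($(h E (s σ) (s τ) hs)).left).trans (Category.assoc _ _ _))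
  have hy : q.left ≫ i.hom ≫ y = x.left := by
    rw [← cancel_epi i'.inv, ← hy, ← Category.assoc, hq, Category.assoc, Iso.inv_hom_id_assoc]
    rfl
  have := isDominant_of_isFieldSpec q
  refine ⟨Over.homMk (i.hom ≫ y) (ext_of_isDominant q.left ?_), Over.OverMorphism.ext hy⟩
  rw [← Category.assoc, hy, Over.w, Over.w]

lemma comp_hom_eq_comp_fromFunctionField {Y X T : Scheme.{u}} [IrreducibleSpace Y]
    (r : Y.PartialMap X) (φ : T ⟶ Spec Y.functionField) (e : T ⟶ r.domain)
    (h : e ≫ r.domain.ι = φ ≫ Y.fromSpecStalk (genericPoint Y)) :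
    e ≫ r.hom = φ ≫ r.fromFunctionField := by
  rw [Scheme.PartialMap.fromFunctionField, Scheme.PartialMap.fromSpecStalkOfMem, ← Category.assoc]
  congr 1
  rw [← cancel_mono r.domain.ι, h, Category.assoc, Scheme.Opens.fromSpecStalkOfMem_ι]

lemma isoImage_top_inv_comp {Y' Y : Scheme.{u}} (p : Y' ⟶ Y)
    (W : (⊤ : Y'.Opens).toScheme.Opens) :
    ((⊤ : Y'.Opens).ι.isoImage W).inv ≫ W.ι ≫ Y'.topIso.hom ≫ p =
      ((⊤ : Y'.Opens).ι ''ᵁ W).ι ≫ p := by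
  rw [Scheme.topIso_hom, ← Category.assoc W.ι, ← Category.assoc, Scheme.Hom.isoImage_inv_ι]

/-- The value at the generic point of the composite of a dominant morphism and a rational map. -/
lemma fromFunctionField_comp {Y' Y X : Scheme.{u}} [IsIntegral Y'] [IsIntegral Y] (p : Y' ⟶ Y)
    [IsDominant p] (ω : Y ⤏ X) (φ : Spec Y'.functionField ⟶ Spec Y.functionField)
    (h : φ ≫ Y.fromSpecStalk (genericPoint Y) = Y'.fromSpecStalk (genericPoint Y') ≫ p) :
    (p.toRationalMap.comp ω).fromFunctionField = φ ≫ ω.fromFunctionField := by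
  obtain ⟨r, rfl⟩ := ω.exists_rep
  rw [Scheme.RationalMap.toRationalMap_comp, Scheme.RationalMap.fromFunctionField_toRationalMap,
    Scheme.RationalMap.fromFunctionField_toRationalMap]
  set r' := p.toPartialMap.comp r
  obtain ⟨m, hm, hm'⟩ : ∃ m : r'.domain.toScheme ⟶ r.domain, m ≫ r.domain.ι = r'.domain.ι ≫ p ∧
      m ≫ r.hom = r'.hom := by
    have h : ((p.toPartialMap.domain.ι.isoImage (p.toPartialMap.hom ⁻¹ᵁ r.domain)).inv ≫
        p.toPartialMap.hom ∣_ r.domain) ≫ r.domain.ι =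
          (p.toPartialMap.domain.ι ''ᵁ p.toPartialMap.hom ⁻¹ᵁ r.domain).ι ≫ p := by
      rw [Category.assoc, morphismRestrict_ι]
      exact isoImage_top_inv_comp p _
    exact ⟨_, h, Category.assoc _ _ _⟩
  obtain ⟨e, he⟩ : ∃ e : Spec Y'.functionField ⟶ r'.domain,
      e ≫ r'.domain.ι = Y'.fromSpecStalk (genericPoint Y') :=
    ⟨r'.domain.fromSpecStalkOfMem _ ((genericPoint_specializes _).mem_open r'.domain.2
      r'.dense_domain.nonempty.choose_spec), Scheme.Opens.fromSpecStalkOfMem_ι _ _ _⟩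
  have h₁ := comp_hom_eq_comp_fromFunctionField r' (𝟙 _) e (by rw [he, Category.id_comp])
  rw [Category.id_comp] at h₁
  rw [← h₁, ← hm', ← Category.assoc]
  refine comp_hom_eq_comp_fromFunctionField r φ (e ≫ m) ?_
  rw [Category.assoc, hm, h, ← Category.assoc, he]

/-! ### Rational maps on their domain of definition -/

section Domain

variable {κ : Type u} [Field κ]

/-- A rational map defined over `κ` is a morphism of `κ`-schemes on its domain of definition. -/
lemma exists_representation {Y X : Over (Spec (CommRingCat.of κ))} [IsIntegral Y.left]
    [IsSeparated X.hom] (θ : Y.left ⤏ X.left) (hθ : DefinedOverBase θ) :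
    ∃ (U : Over (Spec (CommRingCat.of κ))) (j : U ⟶ Y) (f : U ⟶ X),
      IsOpenImmersion j.left ∧ Nonempty U.left ∧
      (∀ y x, HasValue θ y x ↔ ∃ u : geomPt κ ⟶ U, u ≫ j = y ∧ u ≫ f = x) ∧
      ∀ e : genericPt Y ⟶ U, e ≫ j = genericPtHom Y → (e ≫ f).left = θ.fromFunctionField := by
  have : X.left.IsSeparated := by
    have : IsSeparated (terminal.from X.left) := by
      rw [← terminal.comp_from X.hom]; infer_instance
    exact ⟨this⟩
  let : Y.left.Over (Spec (CommRingCat.of κ)) := ⟨Y.hom⟩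
  let : X.left.Over (Spec (CommRingCat.of κ)) := ⟨X.hom⟩
  have : θ.IsOver (Spec (CommRingCat.of κ)) := Scheme.RationalMap.isOver_iff.mpr hθ
  have : θ.toPartialMap.IsOver (Spec (CommRingCat.of κ)) := inferInstance
  have hr : θ.toPartialMap.hom ≫ X.hom = θ.toPartialMap.domain.ι ≫ Y.hom :=
    Scheme.PartialMap.isOver_iff.mp this
  refine ⟨Over.mk (θ.toPartialMap.domain.ι ≫ Y.hom), Over.homMk θ.toPartialMap.domain.ι rfl,
    Over.homMk θ.toPartialMap.hom hr, inferInstanceAs (IsOpenImmersion (Scheme.Opens.ι _)),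
    θ.toPartialMap.dense_domain.nonempty.to_subtype, fun y x ↦ ⟨?_, ?_⟩, fun e he ↦ ?_⟩
  · rintro ⟨f, rfl, h, hy, hx⟩
    have hu : h ≫ Y.left.homOfLE f.le_domain_toRationalMap ≫
        f.toRationalMap.toPartialMap.domain.ι = y.left := by
      rw [← hy]; congr 1; exact Scheme.homOfLE_ι _ _
    have hw : (h ≫ Y.left.homOfLE f.le_domain_toRationalMap) ≫
        f.toRationalMap.toPartialMap.domain.ι ≫ Y.hom = (geomPt κ).hom := by
      rw [Category.assoc, ← Over.w y, ← hu, Category.assoc]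
      exact congrArg (h ≫ ·) (Category.assoc _ _ _).symm
    refine ⟨Over.homMk (h ≫ Y.left.homOfLE f.le_domain_toRationalMap) hw,
      Over.OverMorphism.ext ((Category.assoc _ _ _).trans hu),
      Over.OverMorphism.ext ((Category.assoc _ _ _).trans ?_)⟩
    rw [← hx, ← f.toPartialMap_toRationalMap_restrict]
    rfl
  · rintro ⟨u, rfl, rfl⟩
    exact ⟨θ.toPartialMap, θ.toRationalMap_toPartialMap, u.left, rfl, rfl⟩
  · have h := comp_hom_eq_comp_fromFunctionField θ.toPartialMap (𝟙 _) e.left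
      ((congr(($he).left)).trans (Category.id_comp _).symm)
    rw [Category.id_comp, ← Scheme.RationalMap.fromFunctionField_toRationalMap,
      θ.toRationalMap_toPartialMap] at h
    exact h

end Domain

end FixedPoints

/-! ### The main theorem -/

theorem proposition5p4 {κ : Type u} [Field κ] [CharZero κ]
    -- `G` and `G'` are connected algebraic groups over `κ`
    (G G' : Over (Spec (CommRingCat.of κ))) [GrpObj G] [GrpObj G']
    [LocallyOfFiniteType G.hom] [QuasiCompact G.hom] [GeometricallyIntegral G.hom]
    [LocallyOfFiniteType G'.hom] [QuasiCompact G'.hom] [GeometricallyIntegral G'.hom]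
    -- `X` is an algebraic variety over `κ` on which `G` acts
    (X : Over (Spec (CommRingCat.of κ)))
    [LocallyOfFiniteType X.hom] [QuasiCompact X.hom] [IsSeparated X.hom] [ModObj G X]
    (p : G' ⟶ G) (hp : FixedPoints.IsIsogeny p)
    (θ : G'.left ⤏ X.left) (hθ : FixedPoints.DefinedOverBase θ)
    -- `p(g)` fixes `θ(g)` for every `g` in the domain of `θ`
    (hfix : ∀ (g : FixedPoints.geomPt κ ⟶ G') (x : FixedPoints.geomPt κ ⟶ X),
      FixedPoints.HasValue θ g x → FixedPoints.act (g ≫ p) x = x)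
    -- some element `p(g₀)`, with `g₀` in the domain of `θ`, has only finitely many fixed points
    (hfin : ∃ (g₀ : FixedPoints.geomPt κ ⟶ G') (x₀ : FixedPoints.geomPt κ ⟶ X),
      FixedPoints.HasValue θ g₀ x₀ ∧ (FixedPoints.fixedPoints X (g₀ ≫ p)).Finite) :
    -- `θ` is constant on the fibres of `p`
    (∀ (g₁ g₂ : FixedPoints.geomPt κ ⟶ G') (x₁ x₂ : FixedPoints.geomPt κ ⟶ X),
      FixedPoints.HasValue θ g₁ x₁ → FixedPoints.HasValue θ g₂ x₂ → g₁ ≫ p = g₂ ≫ p → x₁ = x₂) ∧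
    -- `θ = ω ∘ p`, and `g` fixes `ω(g)` for every `g` in the domain of `ω`
    ∃ ω : G.left ⤏ X.left, FixedPoints.DefinedOverBase ω ∧
      θ = FixedPoints.compIsogeny p hp ω ∧
      ∀ (g : FixedPoints.geomPt κ ⟶ G) (x : FixedPoints.geomPt κ ⟶ X),
        FixedPoints.HasValue ω g x → FixedPoints.act g x = x := by
  open FixedPoints in
  have : IsIntegral G'.left := GeometricallyIntegral.isIntegral_of_subsingleton G'.hom
  have : IsIntegral G.left := GeometricallyIntegral.isIntegral_of_subsingleton G.hom
  have := hp.isMonHom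
  have := hp.isFinite
  have := hp.surjective
  obtain ⟨U, j, f, _, _, hval, hgen⟩ := exists_representation θ hθ
  have : LocallyOfFiniteType U.hom := by rw [← Over.w j]; infer_instance
  have : IsIntegral U.left := isIntegral_of_isOpenImmersion j.left
  have hf : (j ≫ p) • f = f := ext_of_geomPt fun u ↦ by
    rw [ModObj.comp_smul, ← Category.assoc]
    exact hfix _ _ ((hval _ _).mpr ⟨u, rfl, rfl⟩)
  obtain ⟨e, he⟩ := exists_lift_of_isDominant j (genericPtHom G')
  have : IsDominant (e ≫ j).left := he ▸ inferInstance
  have := isDominant_of_comp_isOpenImmersion e j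
  have hiso : IsIsolatedFixed (e ≫ j ≫ p) (e ≫ f) := by
    obtain ⟨g₀, x₀, h₀, hfin⟩ := hfin
    obtain ⟨u₀, rfl, -⟩ := (hval _ _).mp h₀
    rw [Category.assoc] at hfin
    exact isIsolatedFixed_of_finite (j ≫ p) f hf u₀ hfin e
  have key {T : Over (Spec (CommRingCat.of κ))} [IsFieldSpec T] (g₁ g₂ : T ⟶ U)
      (h : g₁ ≫ j ≫ p = g₂ ≫ j ≫ p) : g₁ ≫ f = g₂ ≫ f :=
    comp_eq_of_comp_eq (isDominant_id_pow G') hf he hiso g₁ g₂ h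
  refine ⟨fun g₁ g₂ x₁ x₂ h₁ h₂ h ↦ ?_, ?_⟩
  · obtain ⟨u₁, rfl, rfl⟩ := (hval _ _).mp h₁
    obtain ⟨u₂, rfl, rfl⟩ := (hval _ _).mp h₂
    exact key u₁ u₂ (by simpa only [Category.assoc] using h)
  have : IsDominant (genericPtHom G' ≫ p).left := isDominant_left_comp _ _
  obtain ⟨q, hq⟩ := exists_comp_genericPtHom (genericPtHom G' ≫ p)
  have := isFinite_of_genericPtHom_comp p q hq
  -- Constancy on fibres is applied over arbitrary fields here; geometric points over `κ` alone do
  -- not reach the generic fibre.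
  obtain ⟨y, hy⟩ := exists_descent_of_isFinite q (e ≫ f) fun E _ s t h ↦ by
    rw [← Category.assoc, ← Category.assoc]
    refine key _ _ ?_
    simp only [Category.assoc]
    rw [← Category.assoc e, he, ← hq, ← Category.assoc, h, Category.assoc]
  let ω := Scheme.RationalMap.equivFunctionField G.hom X.hom ⟨y.left, Over.w y⟩
  have hω : ω.1.fromFunctionField = y.left :=
    Scheme.RationalMap.fromFunctionField_ofFunctionField _ _ _ _
  refine ⟨ω.1, ω.2, ?_, ?_⟩
  · refine Scheme.RationalMap.eq_of_fromFunctionField_eq _ _ ?_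
    rw [← hgen e he, ← hy]
    refine .trans ?_ (fromFunctionField_comp p.left ω.1 q.left congr(($hq).left)).symm
    rw [hω]
    rfl
  · obtain ⟨V, i, r, _, _, hval', hgen'⟩ := exists_representation ω.1 ω.2
    have : IsIntegral V.left := isIntegral_of_isOpenImmersion i.left
    obtain ⟨d, hd⟩ := exists_lift_of_isDominant i (genericPtHom G)
    have hr : d ≫ r = y := Over.OverMorphism.ext ((hgen' d hd).trans hω)
    have : IsDominant (d ≫ i).left := hd ▸ inferInstance
    have := isDominant_of_comp_isOpenImmersion d i
    have := isDominant_of_isFieldSpec q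
    have := isDominant_left_comp q d
    have hfix' : i • r = r := by
      -- It suffices to compare after pulling back to the generic point of `G'`, where `r` becomes
      -- `f` and the claim is `hf`.
      refine over_ext_of_isDominant (q ≫ d) ?_
      have h : (q ≫ d) ≫ r = e ≫ f := by rw [Category.assoc, hr, hy]
      rw [ModObj.comp_smul, h, Category.assoc, hd, hq, ← he, Category.assoc, ← ModObj.comp_smul, hf]
    rintro g x hx
    obtain ⟨v, rfl, rfl⟩ := (hval' _ _).mp hx
    change (v ≫ i) • (v ≫ r) = v ≫ r
    rw [← ModObj.comp_smul, hfix']
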